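/- Let $\Omega\subset\mathbb R^N$ be open and bounded, let $G_1,G_2\subset\mathbb R^N$ be lattices (discrete subgroups of rank $N$), and let $Q_1,Q_2$ be periodicity cells of $G_1,G_2$, i.e. measurable sets whose translates by $G_i$ tile $\mathbb R^N$ up to null sets. Let $a,b\in\mathbb R^M$, and let $W:\mathbb R^N\times\mathbb R^N\times\mathbb R^M\to\mathbb R$ and $W_1:\mathbb R^M\to\mathbb R$ satisfy the following hypotheses. (H1) For a.e. $y_1\in Q_1$ and a.e. $y_2\in Q_2$, $z\mapsto W(y_1,y_2,z)$ is continuous. For every $z$, $y_1\mapsto W(y_1,y_2,z)$ is Lebesgue measurable for a.e. $y_2$, and $y_2\mapsto W(y_1,y_2,z)$ is Lebesgue measurable for a.e. $y_1$. For a.e. $y_2\in\mathbb R^N$, $W(y_1+\xi_1,y_2,z)=W(y_1,y_2,z)$ for all $y_1$, all $z$ and all $\xi_1\in G_1$; for a.e. $y_1\in\mathbb R^N$, $W(y_1,y_2+\xi_2,z)=W(y_1,y_2,z)$ for all $y_2$, all $z$ and all $\xi_2\in G_2$. (H2) For a.e. $y_1\in Q_1$ and a.e. $y_2\in Q_2$: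 $W(y_1,y_2,z)=0$ if and only if $z\in\{a,b\}$. (H3) There is $R>0$ such that $W_1(z)\ge \frac1R|z|$ whenever $|z|\ge R$. (H5) $0\le W_1(z)\le W(y_1,y_2,z)$ for all $y_1\in Q_1$, $y_2\in Q_2$, $z\in\mathbb R^M$, and $W_1$ is lower semicontinuous (for instance continuous) with $W_1(z)>0$ for $z\notin\{a,b\}$. Let $(\eta_n),(\delta_n),(\varepsilon_n)$ be sequences of positive numbers tending to $0$ with $\eta_n/\delta_n\to0$ and $\delta_n/\varepsilon_n\to0$. For $u\in L^1(\Omega;\mathbb R^M)$ put $$F^{(1)}_n(u)=\int_\Omega\Big[\frac1{\varepsilon_n}W\Big(\frac x{\delta_n},\frac x{\eta_n},u(x)\Big)+\varepsilon_n|\nabla u(x)|^2\Big]\,dx\quad\text{if }u\in W^{1,2}(\Omega;\mathbb R^M),$$ and $F^{(1)}_n(u)=+\infty$ otherwise (the integral being a lower integral if the integrand is not measurable). If $(u_n)\subset L^1(\Omega;\mathbb R^M)$ satisfies $\sup_nF^{(1)}_n(u_n)<\infty$, then there are a subsequence $(u_{n_k})_k\subset W^{1,2}(\Omega;\mathbb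 R^M)$ and a function $u\in BV(\Omega;\{a,b\})$ such that $u_{n_k}\to u$ strongly in $L^1(\Omega;\mathbb R^M)$. Here $BV(\Omega;\{a,b\})$ is the set of $u\in L^1(\Omega;\mathbb R^M)$ with $u(x)\in\{a,b\}$ for a.e. $x\in\Omega$ such that $\{x\in\Omega:u(x)=a\}$ has finite perimeter in $\Omega$. -/

import Mathlib

open MeasureTheory Filter Topology
open scoped ENNReal ContDiff

noncomputable section

namespace PhaseSep

/-- The Euclidean space `ℝⁿ`. -/
abbrev Eu (n : ℕ) : Type := EuclideanSpace ℝ (Fin n)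

/-- The `j`-th vector of the standard basis of `ℝⁿ`. -/
abbrev stdVec {n : ℕ} (j : Fin n) : Eu n := EuclideanSpace.single j (1 : ℝ)

/-- The Lebesgue space `L¹(Ω; ℝᴹ)`, with its norm topology. -/
abbrev LOne {N : ℕ} (Ω : Set (Eu N)) (M : ℕ) : Type :=
  Lp (Eu M) 1 ((volume : Measure (Eu N)).restrict Ω)

/-! ### Sobolev functions -/

/-- `G x j` is the weak partial derivative `∂ⱼ u (x)` on `Ω`, tested against `C_c^∞(Ω)`. -/
def IsWeakGradient {N M : ℕ} (Ω : Set (Eu N)) (u : Eu N → Eu M)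
    (G : Eu N → Fin N → Eu M) : Prop :=
  ∀ (j : Fin N) (φ : Eu N → ℝ), ContDiff ℝ ∞ φ → HasCompactSupport φ → tsupport φ ⊆ Ω →
    ∫ x in Ω, (fderiv ℝ φ x (stdVec j)) • u x = - ∫ x in Ω, φ x • G x j

/-- `u ∈ W^{1,2}(Ω; ℝᴹ)`: `u` and its weak partial derivatives are in `L²(Ω; ℝᴹ)`. -/
def MemW12 {N M : ℕ} (Ω : Set (Eu N)) (u : Eu N → Eu M) : Prop :=
  MemLp u 2 (volume.restrict Ω) ∧
    ∃ G : Eu N → Fin N → Eu M,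
      (∀ j, MemLp (fun x => G x j) 2 (volume.restrict Ω)) ∧ IsWeakGradient Ω u G

/-- The weak gradient of a function in `W^{1,2}(Ω; ℝᴹ)`, unique up to null sets of `Ω`. -/
def weakGradient {N M : ℕ} {Ω : Set (Eu N)} {u : Eu N → Eu M} (h : MemW12 Ω u) :
    Eu N → Fin N → Eu M :=
  h.2.choose

/-! ### Functions of bounded variation with values in `{a, b}` -/

/-- The divergence of a vector field on `ℝᴺ`. -/
def divergence {N : ℕ} (φ : Eu N → Eu N) (x : Eu N) : ℝ :=
  ∑ j : Fin N, (fderiv ℝ φ x (stdVec j)) j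

/-- The perimeter `P(S; A)` of `S` in the open set `A`. -/
def perimeter {N : ℕ} (S A : Set (Eu N)) : ℝ≥0∞ :=
  ⨆ (φ : Eu N → Eu N) (_ : ContDiff ℝ 1 φ) (_ : HasCompactSupport φ) (_ : tsupport φ ⊆ A)
    (_ : ∀ x, ‖φ x‖ ≤ 1), ENNReal.ofReal (∫ x in S, divergence φ x)

/-- `u ∈ BV(Ω; {a, b})`: `u ∈ L¹(Ω; ℝᴹ)` takes a.e. only the values `a` and `b`, and
`{u = a}` has finite perimeter in `Ω`. -/
def MemBVTwo {N M : ℕ} {Ω : Set (Eu N)} (a b : Eu M) (u : LOne Ω M) : Prop :=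
  (∀ᵐ x ∂(volume.restrict Ω), u x = a ∨ u x = b) ∧
    perimeter {x | x ∈ Ω ∧ u x = a} Ω < ⊤

/-! ### The potential -/

/-- (H1): `W` is a Carathéodory function, periodic in the two spatial variables. -/
structure HypCaratheodory {N M : ℕ} (G₁ G₂ : Submodule ℤ (Eu N)) (Q₁ Q₂ : Set (Eu N))
    (W : Eu N → Eu N → Eu M → ℝ) : Prop where
  continuous : ∀ᵐ y₁ ∂(volume.restrict Q₁), ∀ᵐ y₂ ∂(volume.restrict Q₂),
    Continuous fun z => W y₁ y₂ z
  measurable_fst : ∀ z, ∀ᵐ y₂ : Eu N, AEMeasurable (fun y₁ => W y₁ y₂ z) volume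
  measurable_snd : ∀ z, ∀ᵐ y₁ : Eu N, AEMeasurable (fun y₂ => W y₁ y₂ z) volume
  periodic_fst : ∀ᵐ y₂ : Eu N, ∀ z, ∀ y₁, ∀ ξ ∈ G₁, W (y₁ + ξ) y₂ z = W y₁ y₂ z
  periodic_snd : ∀ᵐ y₁ : Eu N, ∀ z, ∀ y₂, ∀ ξ ∈ G₂, W y₁ (y₂ + ξ) z = W y₁ y₂ z

/-- (H2): the wells of `W` are exactly `a` and `b`. -/
def HypWells {N M : ℕ} (Q₁ Q₂ : Set (Eu N)) (W : Eu N → Eu N → Eu M → ℝ) (a b : Eu M) : Prop :=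
  ∀ᵐ y₁ ∂(volume.restrict Q₁), ∀ᵐ y₂ ∂(volume.restrict Q₂), ∀ z,
    W y₁ y₂ z = 0 ↔ (z = a ∨ z = b)

/-- (H3): linear growth at infinity of the lower bound `W₁`. -/
def HypGrowth {M : ℕ} (W₁ : Eu M → ℝ) : Prop :=
  ∃ R : ℝ, 0 < R ∧ ∀ z, R ≤ ‖z‖ → (1 / R) * ‖z‖ ≤ W₁ z

/-- (H5): `W₁` is a spatially uniform lower bound of `W` and a phase separation potential for
the wells `a`, `b`: it is lower semicontinuous and vanishes nowhere else. -/
structure HypLowerBound {N M : ℕ} (Q₁ Q₂ : Set (Eu N)) (W : Eu N → Eu N → Eu M → ℝ)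
    (a b : Eu M) (W₁ : Eu M → ℝ) : Prop where
  nonneg : ∀ z, 0 ≤ W₁ z
  le : ∀ y₁ ∈ Q₁, ∀ y₂ ∈ Q₂, ∀ z, W₁ z ≤ W y₁ y₂ z
  lsc : LowerSemicontinuous W₁
  pos : ∀ z, z ≠ a → z ≠ b → 0 < W₁ z

/-! ### The energy -/

open Classical in
/-- The energy `∫_Ω [ε⁻¹ W(x/δ, x/η, u) + ε |∇u|²] dx` for `u ∈ W^{1,2}(Ω; ℝᴹ)`, and `+∞` for the
other `u ∈ L¹(Ω; ℝᴹ)`. Here `|∇u|² = ∑ⱼ |∂ⱼ u|²` (Frobenius norm). -/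
def energy {N M : ℕ} (Ω : Set (Eu N)) (W : Eu N → Eu N → Eu M → ℝ) (η δ ε : ℝ)
    (u : LOne Ω M) : ℝ≥0∞ :=
  if h : MemW12 Ω u then
    ∫⁻ x in Ω, ENNReal.ofReal
      ((1 / ε) * W (δ⁻¹ • x) (η⁻¹ • x) (u x) + ε * ∑ j, ‖weakGradient h x j‖ ^ 2)
  else ⊤

end PhaseSep

end

/-!
The two scales of oscillation play no role beyond a lower bound: by periodicity,
`W (x / δ) (x / η) z ≥ W₁ z` for almost every `x` (`ae_le_potential`), so the energies dominate
Modica–Mortola energies `∫_Ω ε⁻¹ W₁ (u) + ε |∇u|²` with one fixed potential. What remains is the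
classical compactness theorem, under very weak assumptions on `W₁` and on the boundary of `Ω`.

The proof uses only translations, in place of mollification, chain rule and BV theory. A function
in `W^{1,2}` satisfies `‖u(· + e) - u‖₂ ≤ ‖e‖ ‖∇u‖₂` away from the boundary
(`lintegral_enorm_sub_sq_le`). Let `ψ` be a cutoff around the well `a` that vanishes near `b`.
It varies only on an annulus, where `W₁` is bounded below, so that for every `t > 0`
`|ψ q - ψ p| ≤ A (t W₁ p + t⁻¹ |q - p|²) + B |q - p|²` (`exists_phaseFunction`). For `p = u x`,
`q = u (x + e)` and `t = ‖e‖ / ε` the first term integrates to the energy times `‖e‖`, and the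
quadratic remainder disappears when the translation is divided into many small ones
(`lintegral_sub_le_of_step`). Thus `‖ψ(u)(· + e) - ψ(u)‖₁ ≤ C ‖e‖` with `C` independent of `n`.

Such a bound gives precompactness of `ψ(uₙ)` in `L¹(Ω)`
(`exists_subseq_cauchy_of_translationBound`). Since `∫_Ω W₁ (uₙ) → 0` and `W₁` grows linearly, `uₙ`
is `L¹`-close to the combination `ψ(uₙ) a + (1 - ψ(uₙ)) b`
(`tendsto_lintegral_of_tendsto_potential`), hence a subsequence converges to some `v`; the same lemma
shows that `v` takes values in `{a, b}`. The indicator of `{v = a}` is the limit of `ψ(uₙ)`, inherits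
the translation bound, and therefore has finite perimeter (`perimeter_lt_top_of_translationBound`).
-/

namespace PhaseSep

/-! ### Deep interiors of an open set -/

/-- The points of `Ω` at distance more than `r` from the complement of `Ω` (all points, when the
complement is empty). Translations by vectors of norm at most `r` map it into `Ω`. -/
def deepInterior {N : ℕ} (Ω : Set (Eu N)) (r : ℝ) : Set (Eu N) := (Metric.cthickening r Ωᶜ)ᶜ

theorem isOpen_deepInterior {N : ℕ} (Ω : Set (Eu N)) (r : ℝ) : IsOpen (deepInterior Ω r) :=
  Metric.isClosed_cthickening.isOpen_compl

theorem deepInterior_anti {N : ℕ} (Ω : Set (Eu N)) {r s : ℝ} (h : r ≤ s) :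
    deepInterior Ω s ⊆ deepInterior Ω r :=
  Set.compl_subset_compl.2 (Metric.cthickening_mono h _)

theorem deepInterior_subset {N : ℕ} (Ω : Set (Eu N)) (r : ℝ) : deepInterior Ω r ⊆ Ω := by
  intro x hx
  by_contra h
  exact hx (Metric.self_subset_cthickening Ωᶜ h)

theorem add_mem_deepInterior {N : ℕ} {Ω : Set (Eu N)} {r s : ℝ} (hr : 0 ≤ r) {x e : Eu N}
    (hx : x ∈ deepInterior Ω (r + s)) (he : ‖e‖ ≤ s) : x + e ∈ deepInterior Ω r := by
  intro h
  apply hx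
  refine Metric.cthickening_cthickening_subset ((norm_nonneg e).trans he) hr Ωᶜ |>.trans
    (by rw [add_comm]) ?_
  exact Metric.mem_cthickening_of_dist_le _ _ _ _ h (by simpa [dist_eq_norm] using he)

theorem add_mem_of_mem_deepInterior {N : ℕ} {Ω : Set (Eu N)} {r : ℝ} {x e : Eu N}
    (hx : x ∈ deepInterior Ω r) (he : ‖e‖ ≤ r) : x + e ∈ Ω :=
  deepInterior_subset Ω 0 (add_mem_deepInterior le_rfl (by simpa using hx) he)

theorem exists_subset_deepInterior {N : ℕ} {Ω K : Set (Eu N)} (hΩ : IsOpen Ω) (hK : IsCompact K)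
    (h : K ⊆ Ω) : ∃ r, 0 < r ∧ K ⊆ deepInterior Ω r := by
  obtain ⟨r, hr, hd⟩ := (Set.disjoint_compl_right_iff_subset.2 h).exists_cthickenings hK
    hΩ.isClosed_compl
  exact ⟨r, hr, fun x hx hx' => Set.disjoint_left.1 hd (Metric.self_subset_cthickening K hx) hx'⟩

/-- A bounded open set is exhausted in measure by its deep interiors. -/
theorem exists_volume_diff_deepInterior_lt {N : ℕ} {Ω : Set (Eu N)} (hΩ : IsOpen Ω)
    (hΩb : Bornology.IsBounded Ω) {τ : ℝ≥0∞} (hτ : 0 < τ) {h₀ : ℝ} (hh₀ : 0 < h₀) :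
    ∃ h, 0 < h ∧ h ≤ h₀ ∧ volume (Ω \ deepInterior Ω h) < τ := by
  let s : ℕ → Set (Eu N) := fun n => Ω \ deepInterior Ω (1 / ((n : ℝ) + 1))
  have hanti : Antitone s := fun n m hnm => Set.sdiff_subset_sdiff_right
    (deepInterior_anti Ω (Nat.one_div_le_one_div hnm))
  have hempty : ⋂ n, s n = ∅ := by
    rw [Set.eq_empty_iff_forall_notMem]
    intro x hx
    rw [Set.mem_iInter] at hx
    obtain ⟨r, hr, hsub⟩ := exists_subset_deepInterior hΩ (isCompact_singleton (x := x))
      (by simpa using (hx 0).1)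
    obtain ⟨n, hn⟩ := exists_nat_one_div_lt hr
    exact (hx n).2 (deepInterior_anti Ω hn.le (hsub rfl))
  have ht := tendsto_measure_iInter_atTop (μ := (volume : Measure (Eu N))) (s := s)
    (fun n => (hΩ.measurableSet.diff (isOpen_deepInterior _ _).measurableSet).nullMeasurableSet)
    hanti ⟨0, ((measure_mono Set.sdiff_subset).trans_lt hΩb.measure_lt_top).ne⟩
  rw [hempty, measure_empty] at ht
  have h2 : Tendsto (fun n : ℕ => 1 / ((n : ℝ) + 1)) atTop (𝓝 0) :=
    tendsto_one_div_add_atTop_nhds_zero_nat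
  obtain ⟨n, hn1, hn2⟩ := ((ht.eventually_lt_const hτ).and (h2.eventually_le_const hh₀)).exists
  exact ⟨_, Nat.one_div_pos_of_nat, hn2, hn1⟩

/-! ### Translations of Sobolev functions -/

theorem integrable_comp_add_smul {N : ℕ} {F : Type*} [NormedAddCommGroup F] {g : Eu N → F}
    (hg : Integrable g) (e : Eu N) :
    Integrable (fun p : ℝ × Eu N => g (p.2 + p.1 • e))
      ((volume.restrict (Set.Ioc (0 : ℝ) 1)).prod volume) := by
  have hmp : MeasurePreserving (fun p : ℝ × Eu N => (p.1, p.2 + p.1 • e))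
      ((volume.restrict (Set.Ioc (0 : ℝ) 1)).prod volume)
      ((volume.restrict (Set.Ioc (0 : ℝ) 1)).prod volume) :=
    (MeasurePreserving.id _).skew_product (g := fun s x => x + s • e)
      (by simp only [Function.uncurry_def]; fun_prop)
      (ae_of_all _ fun s => (measurePreserving_add_right volume (s • e)).map_eq)
  exact hmp.integrable_comp_of_integrable (hg.comp_snd (volume.restrict (Set.Ioc (0 : ℝ) 1)))

theorem integrable_smul_of_hasCompactSupport {N : ℕ} {F : Type*} [NormedAddCommGroup F]
    [NormedSpace ℝ F] {φ : Eu N → ℝ} (hφ : Continuous φ) (hc : HasCompactSupport φ)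
    {u : Eu N → F} (hu : Integrable u) : Integrable (fun x => φ x • u x) := by
  obtain ⟨C, hC⟩ := hφ.bounded_above_of_compact_support hc
  exact hu.bdd_smul _ hφ.aestronglyMeasurable (ae_of_all _ hC)

/-- **Fundamental theorem of calculus for weak derivatives.** If `g` is the weak derivative of `u`
in the direction `e`, then `u (x + e) - u x` is the integral of `g` along the segment from `x` to
`x + e`, for almost all `x` far enough from the boundary. Both sides have the same integral against
test functions, by Fubini's theorem. -/
theorem ae_sub_eq_integral_of_weakDeriv {N : ℕ} {F : Type*} [NormedAddCommGroup F]
    [NormedSpace ℝ F] [CompleteSpace F] {Ω : Set (Eu N)} {u g : Eu N → F} (hu : Integrable u)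
    (hg : Integrable g) {e : Eu N} {r : ℝ} (he : ‖e‖ ≤ r)
    (h : ∀ φ : Eu N → ℝ, ContDiff ℝ ∞ φ → HasCompactSupport φ → tsupport φ ⊆ Ω →
      ∫ x, (fderiv ℝ φ x e) • u x = - ∫ x, φ x • g x) :
    ∀ᵐ x, x ∈ deepInterior Ω r →
      u (x + e) - u x = ∫ s in Set.Ioc (0 : ℝ) 1, g (x + s • e) := by
  have hgi := integrable_comp_add_smul hg e
  have hI : Integrable (fun x => ∫ s in Set.Ioc (0 : ℝ) 1, g (x + s • e)) :=
    hgi.integral_prod_right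
  have hue : Integrable (fun x => u (x + e)) := hu.comp_add_right e
  have key := (isOpen_deepInterior Ω r).ae_eq_zero_of_integral_contDiff_smul_eq_zero
    (μ := volume) (f := fun x => u (x + e) - u x - ∫ s in Set.Ioc (0 : ℝ) 1, g (x + s • e))
    (by simpa using! ((hue.sub hu).sub hI).locallyIntegrable.locallyIntegrableOn _) ?_
  · filter_upwards [key] with x hx hx'
    exact sub_eq_zero.1 (hx hx')
  intro φ hφ hφc hφs
  have hφ1 : ContDiff ℝ 1 φ := hφ.of_le (by exact_mod_cast le_top)
  have hφd : Differentiable ℝ φ := hφ1.differentiable one_ne_zero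
  -- The translates of `φ` towards `x + e` stay supported in `Ω`, so they are test functions.
  have htr : ∀ s : ℝ, s ∈ Set.Icc (0 : ℝ) 1 →
      ∫ x, (fderiv ℝ φ (x - s • e) e) • u x = - ∫ x, φ (x - s • e) • g x := by
    intro s hs
    have hcs : HasCompactSupport (fun x => φ (x - s • e)) := by
      simpa [sub_eq_add_neg] using! hφc.comp_homeomorph (Homeomorph.addRight (-(s • e)))
    have := h (fun x => φ (x - s • e)) (hφ.comp (contDiff_id.sub contDiff_const)) hcs ?_
    · simpa [fderiv_comp_sub] using this
    · intro x hx
      have : x - s • e ∈ tsupport φ :=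
        closure_minimal (s := Function.support fun x => φ (x - s • e))
          (t := (fun x => x - s • e) ⁻¹' tsupport φ)
          (fun y hy => subset_tsupport φ hy)
          ((isClosed_tsupport φ).preimage (by fun_prop)) hx
      have h2 := add_mem_of_mem_deepInterior (hφs this) (e := s • e) ?_
      · simpa using h2
      · rw [norm_smul, Real.norm_of_nonneg hs.1]
        exact (mul_le_of_le_one_left (norm_nonneg e) hs.2).trans he
  have hftc : ∀ x, φ (x - e) - φ x = ∫ s in Set.Ioc (0 : ℝ) 1, -(fderiv ℝ φ (x - s • e) e) := by
    intro x
    rw [← intervalIntegral.integral_of_le zero_le_one]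
    rw [intervalIntegral.integral_eq_sub_of_hasDerivAt (f := fun s : ℝ => φ (x - s • e))]
    · simp
    · intro s _
      have h1 : HasDerivAt (fun s : ℝ => x - s • e) (-e) s := by
        simpa using ((hasDerivAt_id s).smul_const e).const_sub x
      have := (hφd (x - s • e)).hasFDerivAt.comp_hasDerivAt s h1
      simpa [Function.comp_def] using this
    · apply Continuous.intervalIntegrable
      have := hφ1.continuous_fderiv one_ne_zero
      fun_prop
  have hφ' : Continuous fun x => fderiv ℝ φ x e :=
    (hφ1.continuous_fderiv one_ne_zero).clm_apply continuous_const
  have hφ'c : HasCompactSupport fun x => fderiv ℝ φ x e := hφc.fderiv_apply ℝ e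
  obtain ⟨C', hC'⟩ := hφ'.bounded_above_of_compact_support hφ'c
  obtain ⟨C, hC⟩ := hφ.continuous.bounded_above_of_compact_support hφc
  have hint1 : Integrable (fun p : ℝ × Eu N => -(fderiv ℝ φ (p.2 - p.1 • e) e) • u p.2)
      ((volume.restrict (Set.Ioc (0 : ℝ) 1)).prod volume) := by
    refine (hu.comp_snd (volume.restrict (Set.Ioc (0 : ℝ) 1))).bdd_smul C' ?_ ?_
    · apply Continuous.aestronglyMeasurable
      exact (hφ'.comp (by fun_prop : Continuous fun p : ℝ × Eu N => p.2 - p.1 • e)).neg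
    · exact ae_of_all _ fun p => by simpa using hC' _
  have hint2 : Integrable (fun p : ℝ × Eu N => φ p.2 • g (p.2 + p.1 • e))
      ((volume.restrict (Set.Ioc (0 : ℝ) 1)).prod volume) := by
    refine hgi.bdd_smul C ?_ ?_
    · exact (hφ.continuous.comp continuous_snd).aestronglyMeasurable
    · exact ae_of_all _ fun p => hC _
  have hs1 := integrable_smul_of_hasCompactSupport hφ.continuous hφc hue
  have hs2 := integrable_smul_of_hasCompactSupport hφ.continuous hφc hu
  have hs3 := integrable_smul_of_hasCompactSupport hφ.continuous hφc hI
  have hs4 : Integrable fun x => φ (x - e) • u x := by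
    simpa using hs1.comp_sub_right e
  have h1 : ∫ x, φ x • u (x + e) = ∫ x, φ (x - e) • u x := by
    rw [← integral_sub_right_eq_self (fun x => φ x • u (x + e)) e]
    simp
  have h2 : ∫ x, (φ (x - e) - φ x) • u x
      = ∫ x, φ x • ∫ s in Set.Ioc (0 : ℝ) 1, g (x + s • e) := by
    calc ∫ x, (φ (x - e) - φ x) • u x
        = ∫ x, ∫ s in Set.Ioc (0 : ℝ) 1, -(fderiv ℝ φ (x - s • e) e) • u x := by
          simp_rw [hftc, integral_smul_const]
      _ = ∫ s in Set.Ioc (0 : ℝ) 1, ∫ x, -(fderiv ℝ φ (x - s • e) e) • u x :=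
          (integral_integral_swap hint1).symm
      _ = ∫ s in Set.Ioc (0 : ℝ) 1, ∫ x, φ x • g (x + s • e) := by
          refine setIntegral_congr_fun measurableSet_Ioc fun s hs => ?_
          simp only [neg_smul, integral_neg]
          rw [htr s ⟨hs.1.le, hs.2⟩, neg_neg,
            ← integral_sub_right_eq_self (fun x => φ x • g (x + s • e)) (s • e)]
          simp
      _ = ∫ x, ∫ s in Set.Ioc (0 : ℝ) 1, φ x • g (x + s • e) := integral_integral_swap hint2
      _ = _ := by simp_rw [integral_smul]
  have hs12 : Integrable fun x => φ x • u (x + e) - φ x • u x := hs1.sub hs2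
  simp_rw [smul_sub]
  rw [integral_sub hs12 hs3, integral_sub hs1 hs2, h1, ← h2, sub_eq_zero]
  simp_rw [sub_smul]
  rw [integral_sub hs4 hs2]


theorem sq_lintegral_le {α : Type*} [MeasurableSpace α] {μ : Measure α} [IsProbabilityMeasure μ]
    {f : α → ℝ≥0∞} (hf : AEMeasurable f μ) : (∫⁻ x, f x ∂μ) ^ 2 ≤ ∫⁻ x, f x ^ 2 ∂μ := by
  have h := ENNReal.lintegral_mul_le_Lp_mul_Lq μ Real.HolderConjugate.two_two hf
    (aemeasurable_const (b := (1 : ℝ≥0∞)))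
  simp only [Pi.mul_apply, mul_one, ENNReal.one_rpow, lintegral_const, measure_univ] at h
  calc _ ≤ ((∫⁻ x, f x ^ (2 : ℝ) ∂μ) ^ (1 / (2 : ℝ))) ^ 2 := by gcongr
    _ = ∫⁻ x, f x ^ 2 ∂μ := by
      rw [← ENNReal.rpow_natCast, ← ENNReal.rpow_mul]
      norm_num

/-- The difference quotient estimate for functions with a weak derivative `g ∈ L²` in the direction
`e`; the step is absorbed into the vector `e`. -/
theorem lintegral_enorm_sub_sq_le_of_weakDeriv {N : ℕ} {F : Type*} [NormedAddCommGroup F]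
    [NormedSpace ℝ F] [CompleteSpace F] {Ω : Set (Eu N)} {u g : Eu N → F} (hu : Integrable u)
    (hg : Integrable g) {e : Eu N} {r : ℝ} (he : ‖e‖ ≤ r)
    (h : ∀ φ : Eu N → ℝ, ContDiff ℝ ∞ φ → HasCompactSupport φ → tsupport φ ⊆ Ω →
      ∫ x, (fderiv ℝ φ x e) • u x = - ∫ x, φ x • g x) :
    ∫⁻ x in deepInterior Ω r, ‖u (x + e) - u x‖ₑ ^ 2 ≤ ∫⁻ x, ‖g x‖ₑ ^ 2 := by
  have hgi := integrable_comp_add_smul hg e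
  have : IsProbabilityMeasure (volume.restrict (Set.Ioc (0 : ℝ) 1)) := ⟨by simp⟩
  calc ∫⁻ x in deepInterior Ω r, ‖u (x + e) - u x‖ₑ ^ 2
      ≤ ∫⁻ x in deepInterior Ω r, ∫⁻ s in Set.Ioc (0 : ℝ) 1, ‖g (x + s • e)‖ₑ ^ 2 := by
        refine setLIntegral_mono_ae' (isOpen_deepInterior _ _).measurableSet ?_
        filter_upwards [ae_sub_eq_integral_of_weakDeriv hu hg he h, hgi.prod_left_ae]
          with x hx hx' hxr
        rw [hx hxr]
        exact (pow_le_pow_left' (enorm_integral_le_lintegral_enorm _) 2).trans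
          (sq_lintegral_le hx'.aestronglyMeasurable.enorm)
    _ ≤ ∫⁻ x, ∫⁻ s in Set.Ioc (0 : ℝ) 1, ‖g (x + s • e)‖ₑ ^ 2 := setLIntegral_le_lintegral _ _
    _ = ∫⁻ s in Set.Ioc (0 : ℝ) 1, ∫⁻ x, ‖g (x + s • e)‖ₑ ^ 2 :=
        (lintegral_lintegral_swap (f := fun (s : ℝ) (x : Eu N) => ‖g (x + s • e)‖ₑ ^ 2)
          (hgi.aestronglyMeasurable.enorm.pow_const 2)).symm
    _ = _ := by
        simp_rw [lintegral_add_right_eq_self (fun x => ‖g x‖ₑ ^ 2)]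
        simp

/-- The Dirichlet energy `∫_Ω |G|²` of a candidate gradient `G`, with the Frobenius norm. -/
noncomputable def gradEnergy {N M : ℕ} (Ω : Set (Eu N)) (G : Eu N → Fin N → Eu M) : ℝ≥0∞ :=
  ∫⁻ x in Ω, ENNReal.ofReal (∑ j, ‖G x j‖ ^ 2)

theorem enorm_sum_smul_sq_le {N M : ℕ} (e : Eu N) (G : Fin N → Eu M) :
    ‖∑ j, e j • G j‖ₑ ^ 2 ≤ ‖e‖ₑ ^ 2 * ENNReal.ofReal (∑ j, ‖G j‖ ^ 2) := by
  have h : ‖∑ j, e j • G j‖ ^ 2 ≤ ‖e‖ ^ 2 * ∑ j, ‖G j‖ ^ 2 := by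
    calc ‖∑ j, e j • G j‖ ^ 2 ≤ (∑ j, ‖e j‖ * ‖G j‖) ^ 2 := by
          gcongr
          exact (norm_sum_le _ _).trans_eq (by simp_rw [norm_smul])
      _ ≤ (∑ j, ‖e j‖ ^ 2) * ∑ j, ‖G j‖ ^ 2 := Finset.sum_mul_sq_le_sq_mul_sq _ _ _
      _ = _ := by rw [EuclideanSpace.norm_sq_eq]
  rw [← ofReal_norm, ← ofReal_norm, ← ENNReal.ofReal_pow (norm_nonneg _),
    ← ENNReal.ofReal_pow (norm_nonneg _), ← ENNReal.ofReal_mul (by positivity)]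
  exact ENNReal.ofReal_le_ofReal h

/-- The difference quotient estimate for `W^{1,2}`: away from the boundary, translating by `e`
changes `u` by at most `‖e‖ ‖∇u‖` in `L²`. -/
theorem lintegral_enorm_sub_sq_le {N M : ℕ} {Ω : Set (Eu N)} (hΩ : IsOpen Ω)
    (hΩb : Bornology.IsBounded Ω) {u : Eu N → Eu M} {G : Eu N → Fin N → Eu M}
    (hu : MemLp u 2 (volume.restrict Ω)) (hG : ∀ j, MemLp (fun x => G x j) 2 (volume.restrict Ω))
    (hw : IsWeakGradient Ω u G) {e : Eu N} {r : ℝ} (he : ‖e‖ ≤ r) :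
    ∫⁻ x in deepInterior Ω r, ‖u (x + e) - u x‖ₑ ^ 2 ≤ ‖e‖ₑ ^ 2 * gradEnergy Ω G := by
  have : IsFiniteMeasure (volume.restrict Ω) := ⟨by simpa using hΩb.measure_lt_top⟩
  have hui : Integrable (Ω.indicator u) :=
    (integrable_indicator_iff hΩ.measurableSet).2 (hu.integrable one_le_two)
  have hGi : ∀ j, Integrable (fun x => G x j) (volume.restrict Ω) :=
    fun j => (hG j).integrable one_le_two
  have hgi : Integrable (Ω.indicator fun x => ∑ j, e j • G x j) :=
    (integrable_indicator_iff hΩ.measurableSet).2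
      (integrable_finsetSum _ fun j _ => (hGi j).smul (e j))
  have hesum : e = ∑ j, e j • stdVec j := by
    ext i
    simp [Finset.sum_apply, Pi.single_apply]
  have key := lintegral_enorm_sub_sq_le_of_weakDeriv (Ω := Ω) hui hgi he ?_
  · calc ∫⁻ x in deepInterior Ω r, ‖u (x + e) - u x‖ₑ ^ 2
        = ∫⁻ x in deepInterior Ω r, ‖Ω.indicator u (x + e) - Ω.indicator u x‖ₑ ^ 2 := by
          refine setLIntegral_congr_fun (isOpen_deepInterior _ _).measurableSet fun x hx => ?_
          simp only [Set.indicator_of_mem (add_mem_of_mem_deepInterior hx he),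
            Set.indicator_of_mem (deepInterior_subset _ _ hx)]
      _ ≤ _ := key
      _ = ∫⁻ x in Ω, ‖∑ j, e j • G x j‖ₑ ^ 2 := by
          rw [← lintegral_indicator hΩ.measurableSet]
          congr 1 with x
          by_cases hx : x ∈ Ω <;> simp [hx]
      _ ≤ ∫⁻ x in Ω, ‖e‖ₑ ^ 2 * ENNReal.ofReal (∑ j, ‖G x j‖ ^ 2) :=
          lintegral_mono fun x => enorm_sum_smul_sq_le e (G x)
      _ = _ := by rw [lintegral_const_mul' _ _ (by simp), gradEnergy]
  · intro φ hφ hφc hφs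
    have hφ1 : ContDiff ℝ 1 φ := hφ.of_le (by exact_mod_cast le_top)
    have i1 : ∀ j, Integrable (fun x => fderiv ℝ φ x (stdVec j) • Ω.indicator u x) := fun j =>
      integrable_smul_of_hasCompactSupport
        ((hφ1.continuous_fderiv one_ne_zero).clm_apply continuous_const)
        (hφc.fderiv_apply ℝ (stdVec j)) hui
    have i2 : ∀ j, Integrable (fun x => φ x • Ω.indicator (fun x => G x j) x) := fun j =>
      integrable_smul_of_hasCompactSupport hφ.continuous hφc
        ((integrable_indicator_iff hΩ.measurableSet).2 (hGi j))
    have i1' : ∀ j ∈ Finset.univ,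
        Integrable (fun x => e j • fderiv ℝ φ x (stdVec j) • Ω.indicator u x) :=
      fun j _ => (i1 j).smul (e j)
    have i2' : ∀ j ∈ Finset.univ,
        Integrable (fun x => e j • φ x • Ω.indicator (fun x => G x j) x) :=
      fun j _ => (i2 j).smul (e j)
    have hj : ∀ j, ∫ x, fderiv ℝ φ x (stdVec j) • Ω.indicator u x
        = - ∫ x, φ x • Ω.indicator (fun x => G x j) x := by
      intro j
      have := hw j φ hφ hφc hφs
      rw [← integral_indicator hΩ.measurableSet, ← integral_indicator hΩ.measurableSet] at this
      simpa only [Set.indicator_smul] using! this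
    calc ∫ x, fderiv ℝ φ x e • Ω.indicator u x
        = ∫ x, ∑ j, e j • fderiv ℝ φ x (stdVec j) • Ω.indicator u x := by
          congr 1; ext1 x
          conv_lhs => rw [hesum]
          simp only [map_sum, map_smul, smul_eq_mul, Finset.sum_smul, mul_smul]
      _ = ∑ j, e j • ∫ x, fderiv ℝ φ x (stdVec j) • Ω.indicator u x := by
          rw [integral_finsetSum _ i1']
          simp_rw [integral_smul]
      _ = - ∑ j, e j • ∫ x, φ x • Ω.indicator (fun x => G x j) x := by
          simp_rw [hj, smul_neg, Finset.sum_neg_distrib]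
      _ = - ∫ x, φ x • Ω.indicator (fun x => ∑ j, e j • G x j) x := by
          simp_rw [← integral_smul]
          rw [← integral_finsetSum _ i2']
          congr 2; ext1 x
          by_cases hx : x ∈ Ω
          · simp only [Set.indicator_of_mem hx, Finset.smul_sum]
            exact Finset.sum_congr rfl fun j _ => smul_comm _ _ _
          · simp [hx]

/-! ### Translations of phase functions -/

/-- Young's inequality along a translation. The parameter `t` in `hψ` weighs the potential against
the squared increment; integrating with `t = ‖e‖ / ε` turns them into the two terms of the
Modica–Mortola energy, with a bound linear in `‖e‖` up to a quadratic remainder. -/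
theorem lintegral_comp_sub_le_step {N M : ℕ} {Ω : Set (Eu N)} {u : Eu N → Eu M} (hu : Measurable u)
    {V : Eu M → ℝ≥0∞} (hV : Measurable V) {ψ : Eu M → ℝ} {A B I : ℝ≥0∞}
    (hψ : ∀ p q (t : ℝ≥0∞), t ≠ 0 → t ≠ ⊤ →
      ‖ψ q - ψ p‖ₑ ≤ A * (t * V p + t⁻¹ * ‖q - p‖ₑ ^ 2) + B * ‖q - p‖ₑ ^ 2)
    {ε : ℝ≥0∞} (hε : ε ≠ 0) (hε' : ε ≠ ⊤) {e : Eu N} {r : ℝ}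
    (hI : ∫⁻ x in deepInterior Ω r, ‖u (x + e) - u x‖ₑ ^ 2 ≤ ‖e‖ₑ ^ 2 * I) :
    ∫⁻ x in deepInterior Ω r, ‖ψ (u (x + e)) - ψ (u x)‖ₑ
      ≤ A * (ε⁻¹ * (∫⁻ x in Ω, V (u x)) + ε * I) * ‖e‖ₑ + B * I * ‖e‖ₑ ^ 2 := by
  rcases eq_or_ne e 0 with rfl | he
  · simp
  have he0 : ‖e‖ₑ ≠ 0 := by simpa using he
  have he1 : ‖e‖ₑ ≠ ⊤ := enorm_ne_top
  have ht0 : ‖e‖ₑ * ε⁻¹ ≠ 0 := mul_ne_zero he0 (ENNReal.inv_ne_zero.2 hε')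
  have ht1 : ‖e‖ₑ * ε⁻¹ ≠ ⊤ := ENNReal.mul_ne_top he1 (ENNReal.inv_ne_top.2 hε)
  have hm : Measurable fun x => ‖u (x + e) - u x‖ₑ ^ 2 :=
    ((hu.comp (measurable_add_const e)).sub hu).enorm.pow_const 2
  have hm' : Measurable fun x => V (u x) := hV.comp hu
  calc _ ≤ ∫⁻ x in deepInterior Ω r, (A * (‖e‖ₑ * ε⁻¹ * V (u x)
          + (‖e‖ₑ * ε⁻¹)⁻¹ * ‖u (x + e) - u x‖ₑ ^ 2) + B * ‖u (x + e) - u x‖ₑ ^ 2) :=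
        lintegral_mono fun x => hψ _ _ _ ht0 ht1
    _ = A * (‖e‖ₑ * ε⁻¹ * (∫⁻ x in deepInterior Ω r, V (u x)) + (‖e‖ₑ * ε⁻¹)⁻¹ *
          ∫⁻ x in deepInterior Ω r, ‖u (x + e) - u x‖ₑ ^ 2)
          + B * ∫⁻ x in deepInterior Ω r, ‖u (x + e) - u x‖ₑ ^ 2 := by
        rw [lintegral_add_right _ (hm.const_mul B), lintegral_const_mul _ hm,
          lintegral_const_mul _ (by fun_prop),
          lintegral_add_right _ (hm.const_mul _), lintegral_const_mul _ hm,
          lintegral_const_mul _ hm']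
    _ ≤ A * (‖e‖ₑ * ε⁻¹ * (∫⁻ x in Ω, V (u x)) + (‖e‖ₑ * ε⁻¹)⁻¹ * (‖e‖ₑ ^ 2 * I))
          + B * (‖e‖ₑ ^ 2 * I) := by
        gcongr
        exact deepInterior_subset _ _
    _ = _ := by
        have : (‖e‖ₑ * ε⁻¹)⁻¹ * (‖e‖ₑ ^ 2 * I) = ε * I * ‖e‖ₑ := by
          rw [ENNReal.mul_inv (Or.inl he0) (Or.inl he1), inv_inv]
          calc ‖e‖ₑ⁻¹ * ε * (‖e‖ₑ ^ 2 * I) = (‖e‖ₑ⁻¹ * ‖e‖ₑ) * (ε * I * ‖e‖ₑ) := by ring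
            _ = _ := by rw [ENNReal.inv_mul_cancel he0 he1, one_mul]
        rw [this]
        ring

/-- A quadratic remainder in a translation estimate can be dropped: cut the translation by `e` into
`m` translations by `e / m`, add up the estimates, and let `m` tend to infinity. -/
theorem lintegral_sub_le_of_step {N : ℕ} {Ω : Set (Eu N)} {w : Eu N → ℝ} (hw : Measurable w)
    {C D : ℝ≥0∞} (hD : D ≠ ⊤)
    (h : ∀ (e : Eu N) (r : ℝ), ‖e‖ ≤ r → ∫⁻ x in deepInterior Ω r, ‖w (x + e) - w x‖ₑ
      ≤ C * ‖e‖ₑ + D * ‖e‖ₑ ^ 2) {e : Eu N} {r : ℝ} (he : ‖e‖ ≤ r) :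
    ∫⁻ x in deepInterior Ω r, ‖w (x + e) - w x‖ₑ ≤ C * ‖e‖ₑ := by
  have key : ∀ m : ℕ, ∫⁻ x in deepInterior Ω r, ‖w (x + e) - w x‖ₑ
      ≤ C * ‖e‖ₑ + D * ‖e‖ₑ ^ 2 * ((m + 1 : ℕ) : ℝ≥0∞)⁻¹ := by
    intro m
    have hm : (0 : ℝ) < ((m + 1 : ℕ) : ℝ) := by positivity
    set f : Eu N := ((m + 1 : ℕ) : ℝ)⁻¹ • e with hf
    set ρ : ℝ := ((m + 1 : ℕ) : ℝ)⁻¹ * r with hρ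
    have hfr : ‖f‖ ≤ ρ := by
      rw [hf, hρ, norm_smul, Real.norm_of_nonneg (by positivity)]
      gcongr
    have hmf : ((m + 1 : ℕ) : ℝ) • f = e := by rw [hf, smul_inv_smul₀ hm.ne']
    have hmρ : ((m + 1 : ℕ) : ℝ) * ρ = r := by rw [hρ, mul_inv_cancel_left₀ hm.ne']
    have hfe : ((m + 1 : ℕ) : ℝ≥0∞) * ‖f‖ₑ = ‖e‖ₑ := by
      conv_rhs => rw [← hmf, enorm_smul, Real.enorm_of_nonneg hm.le, ENNReal.ofReal_natCast]
    have hmt : ((m + 1 : ℕ) : ℝ≥0∞) ≠ ⊤ := ENNReal.natCast_ne_top _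
    have hm0 : ((m + 1 : ℕ) : ℝ≥0∞) ≠ 0 := by simp
    calc ∫⁻ x in deepInterior Ω r, ‖w (x + e) - w x‖ₑ
        ≤ ∫⁻ x in deepInterior Ω r, ∑ i ∈ Finset.range (m + 1),
            ‖w (x + (i : ℝ) • f + f) - w (x + (i : ℝ) • f)‖ₑ := by
          refine lintegral_mono fun x => ?_
          have : w (x + e) - w x = ∑ i ∈ Finset.range (m + 1),
              (w (x + (i : ℝ) • f + f) - w (x + (i : ℝ) • f)) := by
            have := Finset.sum_range_sub (fun i : ℕ => w (x + (i : ℝ) • f)) (m + 1)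
            simp only [hmf, Nat.cast_zero, zero_smul, add_zero] at this
            rw [← this]
            refine Finset.sum_congr rfl fun i _ => ?_
            rw [Nat.cast_add, Nat.cast_one, add_smul, one_smul, add_assoc]
          rw [this]
          exact enorm_sum_le _ _
      _ = ∑ i ∈ Finset.range (m + 1), ∫⁻ x in deepInterior Ω r,
            ‖w (x + (i : ℝ) • f + f) - w (x + (i : ℝ) • f)‖ₑ := by
          refine lintegral_finsetSum _ fun i _ => ?_
          fun_prop
      _ ≤ ∑ i ∈ Finset.range (m + 1), (C * ‖f‖ₑ + D * ‖f‖ₑ ^ 2) := by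
          refine Finset.sum_le_sum fun i hi => ?_
          refine le_trans ?_ (h f ρ hfr)
          rw [← lintegral_indicator (isOpen_deepInterior _ _).measurableSet,
            ← lintegral_indicator (isOpen_deepInterior _ _).measurableSet,
            ← lintegral_add_right_eq_self ((deepInterior Ω ρ).indicator _) ((i : ℝ) • f)]
          refine lintegral_mono fun x => ?_
          by_cases hx : x ∈ deepInterior Ω r
          · have hx' : x + (i : ℝ) • f ∈ deepInterior Ω ρ := by
              have him : (i : ℝ) + 1 ≤ ((m + 1 : ℕ) : ℝ) := by
                exact_mod_cast Finset.mem_range.1 hi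
              have hρ0 : 0 ≤ ρ := (norm_nonneg f).trans hfr
              refine add_mem_deepInterior (s := (i : ℝ) * ρ) hρ0 ?_ ?_
              · refine deepInterior_anti Ω ?_ hx
                rw [← hmρ]
                nlinarith
              · rw [norm_smul, Real.norm_of_nonneg (by positivity)]
                gcongr
            simp [hx, hx']
          · simp [hx]
      _ = C * ‖e‖ₑ + D * ‖e‖ₑ ^ 2 * ((m + 1 : ℕ) : ℝ≥0∞)⁻¹ := by
          rw [Finset.sum_const, Finset.card_range, nsmul_eq_mul, ← hfe]
          have := ENNReal.mul_inv_cancel hm0 hmt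
          calc ((m + 1 : ℕ) : ℝ≥0∞) * (C * ‖f‖ₑ + D * ‖f‖ₑ ^ 2)
              = C * (((m + 1 : ℕ) : ℝ≥0∞) * ‖f‖ₑ) + D * ‖f‖ₑ ^ 2 * ((m + 1 : ℕ) : ℝ≥0∞)
                * 1 := by ring
            _ = _ := by rw [← this]; ring
  have hlim : Tendsto (fun m : ℕ => C * ‖e‖ₑ + D * ‖e‖ₑ ^ 2 * ((m + 1 : ℕ) : ℝ≥0∞)⁻¹) atTop
      (𝓝 (C * ‖e‖ₑ + D * ‖e‖ₑ ^ 2 * 0)) := by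
    refine tendsto_const_nhds.add (ENNReal.Tendsto.const_mul ?_ (Or.inr (by finiteness)))
    exact ENNReal.tendsto_inv_nat_nhds_zero.comp (tendsto_add_atTop_nat 1)
  rw [mul_zero, add_zero] at hlim
  exact ge_of_tendsto' hlim key


/-! ### Compactness from translation bounds -/

/-- `w` has variation at most `C` in `Ω`, expressed through translations: translating by `e` changes
`w` by at most `C ‖e‖` in `L¹`, on every deep interior where the translate stays inside `Ω`. -/
def TranslationBound {N : ℕ} (Ω : Set (Eu N)) (C : ℝ≥0∞) (w : Eu N → ℝ) : Prop :=
  ∀ (e : Eu N) (r : ℝ), ‖e‖ ≤ r →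
    ∫⁻ x in deepInterior Ω r, ‖w (x + e) - w x‖ₑ ≤ C * ‖e‖ₑ

/-- Weak compactness: the integrals over all measurable sets converge along one subsequence, by the
sequential Banach–Alaoglu theorem in `L²(Ω)`. -/
theorem exists_subseq_tendsto_setIntegral {N : ℕ} {Ω : Set (Eu N)}
    (hΩ : volume Ω ≠ ⊤) {w : ℕ → Eu N → ℝ} (hw : ∀ n, Measurable (w n))
    (hw0 : ∀ n x, |w n x| ≤ 1) :
    ∃ k : ℕ → ℕ, StrictMono k ∧ ∀ s, MeasurableSet s →
      ∃ l : ℝ, Tendsto (fun n => ∫ x in s ∩ Ω, w (k n) x) atTop (𝓝 l) := by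
  have : IsFiniteMeasure (volume.restrict Ω) := ⟨by simpa using hΩ.lt_top⟩
  have hmem : ∀ n, MemLp (w n) 2 (volume.restrict Ω) := fun n =>
    MemLp.of_bound (hw n).aestronglyMeasurable 1 (ae_of_all _ (hw0 n))
  obtain ⟨R, hbd⟩ : ∃ R : ℝ, ∀ n, ‖(hmem n).toLp‖ ≤ R := by
    refine ⟨_, fun n => Lp.norm_le_of_ae_bound zero_le_one ?_⟩
    filter_upwards [(hmem n).coeFn_toLp] with x hx
    rw [hx]
    exact hw0 n x
  have : Fact ((2 : ℝ≥0∞) ≠ ⊤) := ⟨by simp⟩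
  let T : ℕ → WeakDual ℝ (Lp ℝ 2 (volume.restrict Ω)) := fun n =>
    StrongDual.toWeakDual (InnerProductSpace.toDual ℝ (Lp ℝ 2 (volume.restrict Ω)) (hmem n).toLp)
  obtain ⟨φ, _, k, hk, hlim⟩ := WeakDual.isSeqCompact_closedBall (𝕜 := ℝ)
    (E := Lp ℝ 2 (volume.restrict Ω)) 0 R
    (x := T) (fun n => by simpa [T] using hbd n)
  refine ⟨k, hk, fun s hs => ⟨φ (indicatorConstLp 2 hs (measure_ne_top _ s) 1), ?_⟩⟩
  have h1 := ((WeakDual.eval_continuous (𝕜 := ℝ)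
    (indicatorConstLp 2 hs (measure_ne_top (volume.restrict Ω) s) (1 : ℝ))).tendsto φ).comp hlim
  refine h1.congr fun n => ?_
  have h2 : T (k n) (indicatorConstLp 2 hs (measure_ne_top (volume.restrict Ω) s) (1 : ℝ))
      = inner ℝ (hmem (k n)).toLp
        (indicatorConstLp 2 hs (measure_ne_top (volume.restrict Ω) s) (1 : ℝ)) := by
    simp [T]
  simp only [Function.comp_apply]
  rw [h2, real_inner_comm, L2.inner_indicatorConstLp_one, ← Measure.restrict_restrict hs]
  exact integral_congr_ae (ae_restrict_of_ae (hmem (k n)).coeFn_toLp)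


/-- The integral over the closed ball of radius `h` about `x` of the extension of `w` from `Ω` by
zero. -/
noncomputable def ballIntegral {N : ℕ} (Ω : Set (Eu N)) (h : ℝ) (w : Eu N → ℝ) (x : Eu N) : ℝ :=
  ∫ t in Metric.closedBall (0 : Eu N) h, Ω.indicator w (x + t)

theorem measurable_ballIntegral {N : ℕ} {Ω : Set (Eu N)} (hΩ : MeasurableSet Ω) (h : ℝ)
    {w : Eu N → ℝ} (hw : Measurable w) : Measurable (ballIntegral Ω h w) := by
  have : StronglyMeasurable (fun p : Eu N × Eu N => Ω.indicator w (p.1 + p.2)) :=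
    ((hw.indicator hΩ).comp measurable_add).stronglyMeasurable
  exact (this.integral_prod_right' (ν := volume.restrict (Metric.closedBall 0 h))).measurable

theorem ballIntegral_eq {N : ℕ} {Ω : Set (Eu N)} (hΩ : MeasurableSet Ω) (h : ℝ)
    (w : Eu N → ℝ) (x : Eu N) :
    ballIntegral Ω h w x = ∫ y in Metric.closedBall x h ∩ Ω, w y := by
  rw [ballIntegral, ← integral_indicator Metric.isClosed_closedBall.measurableSet,
    ← integral_indicator (Metric.isClosed_closedBall.measurableSet.inter hΩ),
    ← integral_add_left_eq_self ((Metric.closedBall x h ∩ Ω).indicator _) x]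
  congr 1
  ext1 t
  by_cases hx : x + t ∈ Ω <;> by_cases ht : ‖t‖ ≤ h <;> simp [Set.indicator, hx, ht]

theorem enorm_ballIntegral_le {N : ℕ} (Ω : Set (Eu N)) (h : ℝ) {w : Eu N → ℝ}
    (hw0 : ∀ x, |w x| ≤ 1) (x : Eu N) :
    ‖ballIntegral Ω h w x‖ₑ ≤ volume (Metric.closedBall (0 : Eu N) h) := by
  refine (enorm_integral_le_lintegral_enorm _).trans ?_
  calc _ ≤ ∫⁻ t in Metric.closedBall (0 : Eu N) h, 1 := by
        refine lintegral_mono fun t => ?_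
        refine enorm_indicator_le_enorm_self _ _ |>.trans ?_
        rw [← ofReal_norm]
        exact ENNReal.ofReal_le_one.2 (hw0 _)
    _ = _ := by simp

/-- A function with a translation bound is close in `L¹` to its averages over small balls; both are
multiplied here by the volume of the ball. -/
theorem lintegral_sub_ballIntegral_le {N : ℕ} {Ω : Set (Eu N)} {w : Eu N → ℝ} (hw : Measurable w)
    (hw0 : ∀ x, |w x| ≤ 1) {C : ℝ≥0∞} (hC : TranslationBound Ω C w) (h : ℝ) :
    ∫⁻ x in deepInterior Ω h,
      ‖volume.real (Metric.closedBall (0 : Eu N) h) * w x - ballIntegral Ω h w x‖ₑ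
      ≤ volume (Metric.closedBall (0 : Eu N) h) * (C * ENNReal.ofReal h) := by
  have hfin : IsFiniteMeasure (volume.restrict (Metric.closedBall (0 : Eu N) h)) :=
    ⟨by simpa using measure_closedBall_lt_top⟩
  calc _ ≤ ∫⁻ x in deepInterior Ω h, ∫⁻ t in Metric.closedBall (0 : Eu N) h,
          ‖w (x + t) - w x‖ₑ := by
        refine setLIntegral_mono' (isOpen_deepInterior _ _).measurableSet fun x hx => ?_
        have hA : ballIntegral Ω h w x = ∫ t in Metric.closedBall (0 : Eu N) h, w (x + t) := by
          refine setIntegral_congr_fun Metric.isClosed_closedBall.measurableSet fun t ht => ?_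
          exact Set.indicator_of_mem (add_mem_of_mem_deepInterior hx (by simpa using ht)) _
        have hc : volume.real (Metric.closedBall (0 : Eu N) h) * w x
            = ∫ t in Metric.closedBall (0 : Eu N) h, w x := by simp
        have hi : Integrable (fun t => w (x + t))
            (volume.restrict (Metric.closedBall (0 : Eu N) h)) :=
          Integrable.of_bound (hw.comp (measurable_const_add x)).aestronglyMeasurable 1
            (ae_of_all _ fun t => hw0 _)
        rw [hA, hc, ← integral_sub (integrable_const _) hi]
        refine (enorm_integral_le_lintegral_enorm _).trans_eq ?_
        simp_rw [enorm_sub_rev]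
    _ = ∫⁻ t in Metric.closedBall (0 : Eu N) h, ∫⁻ x in deepInterior Ω h,
          ‖w (x + t) - w x‖ₑ := by
        refine lintegral_lintegral_swap (Measurable.aemeasurable ?_)
        simp only [Function.uncurry_def]
        fun_prop
    _ ≤ ∫⁻ t in Metric.closedBall (0 : Eu N) h, C * ENNReal.ofReal h := by
        refine setLIntegral_mono' Metric.isClosed_closedBall.measurableSet fun t ht => ?_
        have ht' : ‖t‖ ≤ h := by simpa using ht
        refine (hC t h ht').trans ?_
        gcongr
        rw [← ofReal_norm]
        exact ENNReal.ofReal_le_ofReal ht'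
    _ = _ := by rw [setLIntegral_const, mul_comm]

/-- **Compactness** in `L¹(Ω)` of bounded sequences with a common translation bound: along a weakly
convergent subsequence the ball averages converge pointwise and boundedly, hence in `L¹`, and they
approximate the functions uniformly. No regularity of the boundary is needed, since the functions
are bounded and the layer near the boundary has small measure. -/
theorem exists_subseq_cauchy_of_translationBound {N : ℕ} {Ω : Set (Eu N)} (hΩ : IsOpen Ω)
    (hΩb : Bornology.IsBounded Ω) {w : ℕ → Eu N → ℝ} (hw : ∀ n, Measurable (w n))
    (hw0 : ∀ n x, |w n x| ≤ 1) {C : ℝ≥0∞} (hC' : C ≠ ⊤) (hC : ∀ n, TranslationBound Ω C (w n)) :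
    ∃ k : ℕ → ℕ, StrictMono k ∧ ∀ τ : ℝ≥0∞, 0 < τ → ∃ n₀, ∀ n ≥ n₀, ∀ m ≥ n₀,
      ∫⁻ x in Ω, ‖w (k n) x - w (k m) x‖ₑ ≤ τ := by
  obtain ⟨k, hk, hlim⟩ := exists_subseq_tendsto_setIntegral hΩb.measure_lt_top.ne hw hw0
  refine ⟨k, hk, ?_⟩
  suffices H : ∀ τ : ℝ≥0∞, 0 < τ → τ ≠ ⊤ → ∃ n₀, ∀ n ≥ n₀, ∀ m ≥ n₀,
      ∫⁻ x in Ω, ‖w (k n) x - w (k m) x‖ₑ ≤ 6 * τ by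
    intro τ hτ
    rcases eq_or_ne τ ⊤ with rfl | hτ'
    · exact ⟨0, fun _ _ _ _ => le_top⟩
    · have := H (τ / 6) (ENNReal.div_pos hτ.ne' (by simp)) (ENNReal.div_ne_top hτ' (by simp))
      rwa [ENNReal.mul_div_cancel (by simp) (by simp)] at this
  intro τ hτ hτ'
  -- `h` is small enough for the averaging error `C h` and the boundary layer to be at most `τ`.
  have hq0 : τ / (C + 1) ≠ 0 := (ENNReal.div_pos hτ.ne' (by finiteness)).ne'
  have hqt : τ / (C + 1) ≠ ⊤ := ENNReal.div_ne_top hτ' (by simp)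
  obtain ⟨h, hh, hh₀, hvol⟩ := exists_volume_diff_deepInterior_lt hΩ hΩb hτ
    (ENNReal.toReal_pos hq0 hqt)
  have hCh : C * ENNReal.ofReal h ≤ τ := by
    calc C * ENNReal.ofReal h ≤ (C + 1) * (τ / (C + 1)) := by
          gcongr
          · exact le_self_add
          · exact (ENNReal.ofReal_le_ofReal hh₀).trans_eq (ENNReal.ofReal_toReal hqt)
      _ = τ := ENNReal.mul_div_cancel (by simp) (by finiteness)
  set K := deepInterior Ω h with hK
  have hKm : MeasurableSet K := (isOpen_deepInterior _ _).measurableSet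
  have hKfin : volume K ≠ ⊤ := ((measure_mono (deepInterior_subset _ _)).trans_lt
    hΩb.measure_lt_top).ne
  set β := volume (Metric.closedBall (0 : Eu N) h) with hβ
  have hβ0 : β ≠ 0 := (Metric.measure_closedBall_pos volume _ hh).ne'
  have hβt : β ≠ ⊤ := measure_closedBall_lt_top.ne
  set A : ℕ → Eu N → ℝ := fun n => ballIntegral Ω h (w (k n)) with hA
  have hAm : ∀ n, Measurable (A n) := fun n => measurable_ballIntegral hΩ.measurableSet h (hw _)
  choose l hl using fun x => hlim (Metric.closedBall x h) Metric.isClosed_closedBall.measurableSet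
  have hl' : ∀ x, Tendsto (fun n => A n x) atTop (𝓝 (l x)) := fun x =>
    (hl x).congr fun n => (ballIntegral_eq hΩ.measurableSet h _ x).symm
  have hlm : Measurable l := measurable_of_tendsto_metrizable hAm (tendsto_pi_nhds.2 hl')
  have hAb : ∀ n x, ‖A n x‖ₑ ≤ β := fun n x => enorm_ballIntegral_le Ω h (hw0 _) x
  have hlb : ∀ x, ‖l x‖ₑ ≤ β := fun x =>
    le_of_tendsto' ((continuous_enorm.tendsto _).comp (hl' x)) fun n => hAb n x
  have hdct : Tendsto (fun n => ∫⁻ x in K, ‖A n x - l x‖ₑ) atTop (𝓝 0) := by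
    have := tendsto_lintegral_of_dominated_convergence (μ := volume.restrict K)
      (F := fun n x => ‖A n x - l x‖ₑ) (f := fun _ => 0) (fun _ => β + β)
      (fun n => ((hAm n).sub hlm).enorm)
      (fun n => ae_of_all _ fun x => (enorm_sub_le).trans (add_le_add (hAb n x) (hlb x)))
      (by rw [setLIntegral_const]; finiteness)
      (ae_of_all _ fun x => by
        have := ((hl' x).sub_const (l x)).enorm
        simpa using this)
    simpa using this
  obtain ⟨n₀, hn₀⟩ := eventually_atTop.1
    (hdct.eventually_lt_const (ENNReal.mul_pos hβ0 hτ.ne'))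
  refine ⟨n₀, fun n hn m hm => ?_⟩
  have hpt : ∀ x, β * ‖w (k n) x - w (k m) x‖ₑ
      ≤ ‖β.toReal * w (k n) x - A n x‖ₑ + ‖A n x - l x‖ₑ + ‖A m x - l x‖ₑ
        + ‖β.toReal * w (k m) x - A m x‖ₑ := by
    intro x
    have h1 : β * ‖w (k n) x - w (k m) x‖ₑ = ‖β.toReal * (w (k n) x - w (k m) x)‖ₑ := by
      rw [enorm_mul, Real.enorm_of_nonneg ENNReal.toReal_nonneg, ENNReal.ofReal_toReal hβt]
    have h2 : β.toReal * (w (k n) x - w (k m) x) = (β.toReal * w (k n) x - A n x)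
        + (A n x - l x) - (A m x - l x) - (β.toReal * w (k m) x - A m x) := by ring
    rw [h1, h2]
    refine enorm_sub_le.trans ?_
    gcongr
    refine enorm_sub_le.trans ?_
    gcongr
    exact enorm_add_le _ _
  have hmeas : ∀ n, Measurable fun x => ‖β.toReal * w (k n) x - A n x‖ₑ := fun n =>
    (((hw _).const_mul _).sub (hAm n)).enorm
  have hmeas' : ∀ n, Measurable fun x => ‖A n x - l x‖ₑ := fun n => ((hAm n).sub hlm).enorm
  have havg : ∀ n, ∫⁻ x in K, ‖β.toReal * w (k n) x - A n x‖ₑ ≤ β * τ := fun n =>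
    (lintegral_sub_ballIntegral_le (hw _) (hw0 _) (hC (k n)) h).trans (by gcongr)
  have hKint : ∫⁻ x in K, ‖w (k n) x - w (k m) x‖ₑ ≤ 4 * τ := by
    refine (ENNReal.mul_le_mul_iff_right hβ0 hβt).1 ?_
    calc β * ∫⁻ x in K, ‖w (k n) x - w (k m) x‖ₑ
        = ∫⁻ x in K, β * ‖w (k n) x - w (k m) x‖ₑ := (lintegral_const_mul' _ _ hβt).symm
      _ ≤ ∫⁻ x in K, (‖β.toReal * w (k n) x - A n x‖ₑ + ‖A n x - l x‖ₑ + ‖A m x - l x‖ₑ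
            + ‖β.toReal * w (k m) x - A m x‖ₑ) := lintegral_mono hpt
      _ = (∫⁻ x in K, ‖β.toReal * w (k n) x - A n x‖ₑ) + (∫⁻ x in K, ‖A n x - l x‖ₑ)
            + (∫⁻ x in K, ‖A m x - l x‖ₑ) + ∫⁻ x in K, ‖β.toReal * w (k m) x - A m x‖ₑ := by
          rw [lintegral_add_right _ (hmeas m), lintegral_add_right _ (hmeas' m),
            lintegral_add_right _ (hmeas' n)]
      _ ≤ β * τ + β * τ + β * τ + β * τ := by
          gcongr
          exacts [havg n, (hn₀ n hn).le, (hn₀ m hm).le, havg m]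
      _ = β * (4 * τ) := by ring
  have hrest : ∫⁻ x in Ω \ K, ‖w (k n) x - w (k m) x‖ₑ ≤ 2 * τ := by
    calc _ ≤ ∫⁻ x in Ω \ K, 2 := by
          refine lintegral_mono fun x => ?_
          refine enorm_sub_le.trans ?_
          rw [← one_add_one_eq_two, ← ofReal_norm, ← ofReal_norm]
          exact add_le_add (ENNReal.ofReal_le_one.2 (hw0 _ _)) (ENNReal.ofReal_le_one.2 (hw0 _ _))
      _ = 2 * volume (Ω \ K) := setLIntegral_const _ _
      _ ≤ _ := by gcongr
  calc ∫⁻ x in Ω, ‖w (k n) x - w (k m) x‖ₑ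
      = (∫⁻ x in Ω ∩ K, ‖w (k n) x - w (k m) x‖ₑ)
          + ∫⁻ x in Ω \ K, ‖w (k n) x - w (k m) x‖ₑ := (lintegral_inter_add_sdiff _ _ hKm).symm
    _ ≤ 4 * τ + 2 * τ := by
        gcongr
        exact (lintegral_mono_set Set.inter_subset_right).trans hKint
    _ = 6 * τ := by ring


/-! ### The double well potential -/

theorem exists_pos_le_of_isCompact {M : ℕ} {W₁ : Eu M → ℝ} {a b : Eu M}
    (hlsc : LowerSemicontinuous W₁) (hpos : ∀ z, z ≠ a → z ≠ b → 0 < W₁ z) {S : Set (Eu M)}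
    (hS : IsCompact S) (ha : a ∉ S) (hb : b ∉ S) : ∃ c, 0 < c ∧ ∀ z ∈ S, c ≤ W₁ z := by
  rcases S.eq_empty_or_nonempty with rfl | hne
  · exact ⟨1, one_pos, by simp⟩
  · obtain ⟨p, hp, hmin⟩ := (hlsc.lowerSemicontinuousOn S).exists_isMinOn hne hS
    exact ⟨W₁ p, hpos p (fun h => ha (h ▸ hp)) (fun h => hb (h ▸ hp)), fun z hz => hmin hz⟩

/-- The cutoff around `a` that is `1` on the ball of radius `s`, is `0` off the ball of radius `2 s`,
and is affine in the distance to `a` in between. -/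
noncomputable def wellCutoff {M : ℕ} (a : Eu M) (s : ℝ) (z : Eu M) : ℝ :=
  max (min (2 - ‖z - a‖ / s) 1) 0

theorem wellCutoff_nonneg {M : ℕ} (a : Eu M) (s : ℝ) (z : Eu M) : 0 ≤ wellCutoff a s z :=
  le_max_right _ _

theorem wellCutoff_le_one {M : ℕ} (a : Eu M) (s : ℝ) (z : Eu M) : wellCutoff a s z ≤ 1 :=
  max_le (min_le_right _ _) zero_le_one

theorem wellCutoff_eq_one {M : ℕ} {a : Eu M} {s : ℝ} (hs : 0 < s) {z : Eu M} (h : ‖z - a‖ ≤ s) :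
    wellCutoff a s z = 1 := by
  have : ‖z - a‖ / s ≤ 1 := (div_le_one hs).2 h
  rw [wellCutoff, min_eq_right (by linarith), max_eq_left zero_le_one]

theorem wellCutoff_eq_zero {M : ℕ} {a : Eu M} {s : ℝ} (hs : 0 < s) {z : Eu M}
    (h : 2 * s ≤ ‖z - a‖) : wellCutoff a s z = 0 := by
  have : 2 ≤ ‖z - a‖ / s := (le_div_iff₀ hs).2 h
  exact max_eq_right ((min_le_left _ _).trans (by linarith))

theorem abs_wellCutoff_sub_le {M : ℕ} (a : Eu M) {s : ℝ} (hs : 0 < s) (p q : Eu M) :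
    |wellCutoff a s q - wellCutoff a s p| ≤ s⁻¹ * ‖q - p‖ := by
  calc _ ≤ |min (2 - ‖q - a‖ / s) 1 - min (2 - ‖p - a‖ / s) 1| := abs_max_sub_max_le_abs _ _ _
    _ ≤ max |(2 - ‖q - a‖ / s) - (2 - ‖p - a‖ / s)| |(1 : ℝ) - 1| := abs_min_sub_min_le_max _ _ _ _
    _ = |(2 - ‖q - a‖ / s) - (2 - ‖p - a‖ / s)| := by simp
    _ = s⁻¹ * |‖p - a‖ - ‖q - a‖| := by
        have : 2 - ‖q - a‖ / s - (2 - ‖p - a‖ / s) = s⁻¹ * (‖p - a‖ - ‖q - a‖) := by ring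
        rw [this, abs_mul, abs_of_pos (inv_pos.2 hs)]
    _ ≤ _ := by
        gcongr
        refine (abs_norm_sub_norm_le _ _).trans_eq ?_
        rw [sub_sub_sub_cancel_right, norm_sub_rev]

theorem abs_wellCutoff_sub_le_one {M : ℕ} (a : Eu M) (s : ℝ) (p q : Eu M) :
    |wellCutoff a s q - wellCutoff a s p| ≤ 1 := by
  have := wellCutoff_nonneg a s p
  have := wellCutoff_nonneg a s q
  have := wellCutoff_le_one a s p
  have := wellCutoff_le_one a s q
  rw [abs_le]
  constructor <;> linarith

/-- At points away from the transition annulus the increments of the cutoff are quadratic: it is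
locally constant there, and only steps longer than `s / 2` can change its value. -/
theorem abs_wellCutoff_sub_le_sq {M : ℕ} (a : Eu M) {s : ℝ} (hs : 0 < s) (p q : Eu M)
    (hp : ‖p - a‖ < s / 2 ∨ 5 * s / 2 < ‖p - a‖) :
    |wellCutoff a s q - wellCutoff a s p| ≤ 4 / s ^ 2 * ‖q - p‖ ^ 2 := by
  by_cases hd : s / 2 ≤ ‖q - p‖
  · refine (abs_wellCutoff_sub_le_one a s p q).trans ?_
    calc (1 : ℝ) = 4 / s ^ 2 * (s / 2) ^ 2 := by field_simp; norm_num
      _ ≤ _ := by gcongr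
  · have : wellCutoff a s q = wellCutoff a s p := by
      push Not at hd
      rcases hp with hp | hp
      · have : ‖q - a‖ ≤ ‖q - p‖ + ‖p - a‖ := norm_sub_le_norm_sub_add_norm_sub _ _ _
        rw [wellCutoff_eq_one hs (by linarith), wellCutoff_eq_one hs (by linarith)]
      · have : ‖p - a‖ ≤ ‖p - q‖ + ‖q - a‖ := norm_sub_le_norm_sub_add_norm_sub _ _ _
        rw [norm_sub_rev p q] at this
        rw [wellCutoff_eq_zero hs (by linarith), wellCutoff_eq_zero hs (by linarith)]
    rw [this, sub_self, abs_zero]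
    positivity

/-- A Lipschitz function `ψ` that tells the wells apart and varies only where the potential is
bounded below. The last estimate takes the place of the chain rule and the Modica–Mortola trick: up
to a quadratic remainder, the increments of `ψ` are controlled by the potential at the base point
and the squared increment, with an arbitrary weight `t`. For equal wells `ψ` is constant. -/
theorem exists_phaseFunction {M : ℕ} {W₁ : Eu M → ℝ} {a b : Eu M}
    (hnn : ∀ z, 0 ≤ W₁ z) (hlsc : LowerSemicontinuous W₁)
    (hpos : ∀ z, z ≠ a → z ≠ b → 0 < W₁ z) :
    ∃ ψ : Eu M → ℝ, Continuous ψ ∧ (∀ z, 0 ≤ ψ z) ∧ (∀ z, ψ z ≤ 1) ∧ ψ a = 1 ∧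
      (b ≠ a → ψ b = 0) ∧ (∃ L : ℝ, 0 ≤ L ∧ ∀ p q, |ψ q - ψ p| ≤ L * ‖q - p‖) ∧
      ∃ A B : ℝ, 0 ≤ A ∧ 0 ≤ B ∧ ∀ p q (t : ℝ), 0 < t →
        |ψ q - ψ p| ≤ A * (t * W₁ p + t⁻¹ * ‖q - p‖ ^ 2) + B * ‖q - p‖ ^ 2 := by
  rcases eq_or_ne b a with rfl | hab
  · exact ⟨fun _ => 1, continuous_const, by simp, by simp, by simp, by simp,
      ⟨0, le_rfl, by simp⟩, 0, 0, le_rfl, le_rfl, by simp⟩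
  -- With a third of the distance, `b` lies outside the ball of radius `5 s / 2` about `a`.
  set s := ‖b - a‖ / 3 with hs_def
  have hba : 0 < ‖b - a‖ := norm_pos_iff.2 (sub_ne_zero.2 hab)
  have hs : 0 < s := by positivity
  obtain ⟨c, hc, hcW⟩ := exists_pos_le_of_isCompact hlsc hpos
    (S := {z | s / 2 ≤ ‖z - a‖ ∧ ‖z - a‖ ≤ 5 * s / 2})
    ((isCompact_closedBall a (5 * s / 2)).of_isClosed_subset
      (IsClosed.inter (s₁ := {z | s / 2 ≤ ‖z - a‖}) (s₂ := {z | ‖z - a‖ ≤ 5 * s / 2})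
        (isClosed_le (by fun_prop) (by fun_prop)) (isClosed_le (by fun_prop) (by fun_prop)))
      fun z hz => by simpa [dist_eq_norm] using hz.2)
    (fun h => by simp at h; linarith [h.1]) (fun h => by have := h.2; linarith)
  refine ⟨wellCutoff a s, by unfold wellCutoff; fun_prop, wellCutoff_nonneg a s,
    wellCutoff_le_one a s, wellCutoff_eq_one hs (by simpa using hs.le),
    fun _ => wellCutoff_eq_zero hs (by linarith),
    ⟨s⁻¹, by positivity, abs_wellCutoff_sub_le a hs⟩,
    s⁻¹ * (1 + c⁻¹), 4 / s ^ 2, by positivity, by positivity, fun p q t ht => ?_⟩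
  by_cases hp : ‖p - a‖ < s / 2 ∨ 5 * s / 2 < ‖p - a‖
  · refine (abs_wellCutoff_sub_le_sq a hs p q hp).trans (le_add_of_nonneg_left ?_)
    have := hnn p
    positivity
  · push Not at hp
    have hW := hcW p hp
    refine ((abs_wellCutoff_sub_le a hs p q).trans ?_).trans (le_add_of_nonneg_right (by positivity))
    rw [mul_assoc]
    gcongr
    have h1 : ‖q - p‖ ≤ t + t⁻¹ * ‖q - p‖ ^ 2 := by
      have h2 : 0 ≤ t⁻¹ * ((t - ‖q - p‖) ^ 2 + t * ‖q - p‖) := by positivity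
      have h3 : t⁻¹ * ((t - ‖q - p‖) ^ 2 + t * ‖q - p‖)
          = t + t⁻¹ * ‖q - p‖ ^ 2 - ‖q - p‖ := by field_simp; ring
      linarith
    have h2 : t ≤ c⁻¹ * (t * W₁ p) := by
      calc t = c⁻¹ * (t * c) := by field_simp
        _ ≤ _ := by gcongr
    have h3 : 0 ≤ t * W₁ p := mul_nonneg ht.le (hnn p)
    have h4 : 0 ≤ c⁻¹ * (t⁻¹ * ‖q - p‖ ^ 2) := by positivity
    linarith

/-- A continuous function of at most linear growth that vanishes at the wells is controlled by the
potential, up to an arbitrarily small constant. -/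
theorem exists_le_add_mul {M : ℕ} {W₁ : Eu M → ℝ} {a b : Eu M}
    (hnn : ∀ z, 0 ≤ W₁ z) (hlsc : LowerSemicontinuous W₁)
    (hpos : ∀ z, z ≠ a → z ≠ b → 0 < W₁ z) (h3 : HypGrowth W₁)
    {f : Eu M → ℝ} (hf : Continuous f) (hfa : f a = 0) (hfb : f b = 0) {D : ℝ} (hD : 0 ≤ D)
    (hfD : ∀ z, f z ≤ ‖z‖ + D) {τ : ℝ} (hτ : 0 < τ) :
    ∃ K, 0 ≤ K ∧ ∀ z, f z ≤ τ + K * W₁ z := by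
  obtain ⟨R, hR, hgrow⟩ := h3
  set ρ := max R 1
  obtain ⟨c, hc, hcW⟩ := exists_pos_le_of_isCompact hlsc hpos
    (S := Metric.closedBall 0 ρ ∩ {z | τ ≤ f z})
    ((isCompact_closedBall 0 ρ).inter_right (isClosed_le continuous_const hf))
    (fun h => by have := h.2; simp only [Set.mem_ofPred_eq] at this; linarith)
    (fun h => by have := h.2; simp only [Set.mem_ofPred_eq] at this; linarith)
  have hρ : 0 ≤ ρ := zero_le_one.trans (le_max_right _ _)
  refine ⟨(ρ + D) / c + (1 + D) * R, by positivity, fun z => ?_⟩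
  have hW := hnn z
  have k1 : 0 ≤ (ρ + D) / c * W₁ z := by positivity
  have k2 : 0 ≤ (1 + D) * R * W₁ z := by positivity
  rw [add_mul]
  by_cases hz : ‖z‖ ≤ ρ
  · by_cases hfz : τ ≤ f z
    · have h1 : c ≤ W₁ z := hcW z ⟨by simpa using hz, hfz⟩
      have h2 : ρ + D ≤ (ρ + D) / c * W₁ z := by
        calc ρ + D = (ρ + D) / c * c := by field_simp
          _ ≤ _ := by gcongr
      linarith [hfD z]
    · linarith
  · push Not at hz
    have h1 := hgrow z ((le_max_left _ _).trans hz.le)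
    have h2 : 1 ≤ ‖z‖ := (le_max_right _ _).trans hz.le
    have h3 : ‖z‖ ≤ R * W₁ z := by
      rw [one_div, inv_mul_le_iff₀ hR] at h1
      exact h1
    have h4 : f z ≤ (1 + D) * (R * W₁ z) := by
      calc f z ≤ ‖z‖ + D := hfD z
        _ ≤ (1 + D) * ‖z‖ := by nlinarith
        _ ≤ _ := by gcongr
    linarith

theorem tendsto_lintegral_of_tendsto_potential {N M : ℕ} {Ω : Set (Eu N)} (hΩ : volume Ω ≠ ⊤)
    {W₁ : Eu M → ℝ} {a b : Eu M}
    (hnn : ∀ z, 0 ≤ W₁ z) (hlsc : LowerSemicontinuous W₁)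
    (hpos : ∀ z, z ≠ a → z ≠ b → 0 < W₁ z) (h3 : HypGrowth W₁)
    {f : Eu M → ℝ} (hf : Continuous f) (hfa : f a = 0) (hfb : f b = 0) {D : ℝ} (hD : 0 ≤ D)
    (hfD : ∀ z, f z ≤ ‖z‖ + D) {u : ℕ → Eu N → Eu M}
    (hW : Tendsto (fun n => ∫⁻ x in Ω, ENNReal.ofReal (W₁ (u n x))) atTop (𝓝 0)) :
    Tendsto (fun n => ∫⁻ x in Ω, ENNReal.ofReal (f (u n x))) atTop (𝓝 0) := by
  rw [ENNReal.tendsto_nhds_zero]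
  intro σ hσ
  obtain ⟨τ, hτ, hτσ⟩ : ∃ τ : ℝ, 0 < τ ∧ ENNReal.ofReal τ * volume Ω < σ := by
    have h1 : Tendsto (fun τ : ℝ => ENNReal.ofReal τ * volume Ω) (𝓝[>] 0) (𝓝 0) := by
      have : Tendsto (fun τ : ℝ => ENNReal.ofReal τ * volume Ω) (𝓝 0)
          (𝓝 (ENNReal.ofReal 0 * volume Ω)) :=
        ENNReal.Tendsto.mul_const (ENNReal.tendsto_ofReal tendsto_id) (Or.inr hΩ)
      rw [ENNReal.ofReal_zero, zero_mul] at this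
      exact this.mono_left nhdsWithin_le_nhds
    obtain ⟨τ, h, h'⟩ := ((h1.eventually_lt_const hσ).and self_mem_nhdsWithin).exists
    exact ⟨τ, h', h⟩
  obtain ⟨K, hK, hfK⟩ := exists_le_add_mul hnn hlsc hpos h3 hf hfa hfb hD hfD hτ
  have h2 : Tendsto (fun n => ENNReal.ofReal τ * volume Ω + ENNReal.ofReal K *
      ∫⁻ x in Ω, ENNReal.ofReal (W₁ (u n x))) atTop
      (𝓝 (ENNReal.ofReal τ * volume Ω + ENNReal.ofReal K * 0)) :=
    tendsto_const_nhds.add (ENNReal.Tendsto.const_mul hW (Or.inr ENNReal.ofReal_ne_top))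
  rw [mul_zero, add_zero] at h2
  filter_upwards [h2.eventually_lt_const hτσ] with n hn
  refine le_trans ?_ hn.le
  calc _ ≤ ∫⁻ x in Ω, (ENNReal.ofReal τ + ENNReal.ofReal K * ENNReal.ofReal (W₁ (u n x))) := by
        refine lintegral_mono fun x => ?_
        rw [← ENNReal.ofReal_mul hK, ← ENNReal.ofReal_add hτ.le (mul_nonneg hK (hnn _))]
        exact ENNReal.ofReal_le_ofReal (hfK _)
    _ = _ := by
        rw [lintegral_add_left measurable_const, setLIntegral_const,
          lintegral_const_mul' _ _ ENNReal.ofReal_ne_top]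

/-! ### Periodicity -/

/-- The lower bound for `W`, assumed on the product of the two cells, holds along almost every point
`(x / δ, x / η)`. The periodicity in the second variable is available only for almost every first
variable, and is needed at the translate of `x / δ` into the first cell; countability of the lattice
makes it available at all its translates. -/
theorem ae_le_potential {N M : ℕ} {G₁ G₂ : Submodule ℤ (Eu N)}
    [DiscreteTopology G₁] {Q₁ Q₂ : Set (Eu N)}
    (hQ₁ : IsAddFundamentalDomain G₁ Q₁ (volume : Measure (Eu N)))
    (hQ₂ : IsAddFundamentalDomain G₂ Q₂ (volume : Measure (Eu N)))
    {W : Eu N → Eu N → Eu M → ℝ} {W₁ : Eu M → ℝ}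
    (h1 : HypCaratheodory G₁ G₂ Q₁ Q₂ W)
    (hle : ∀ y₁ ∈ Q₁, ∀ y₂ ∈ Q₂, ∀ z, W₁ z ≤ W y₁ y₂ z)
    {δ η : ℝ} (hδ : δ ≠ 0) (hη : η ≠ 0) :
    ∀ᵐ x : Eu N, ∀ z, W₁ z ≤ W (δ⁻¹ • x) (η⁻¹ • x) z := by
  have hc : Countable G₁ := TopologicalSpace.separableSpace_iff_countable.1 inferInstance
  have hB : ∀ᵐ y₁ : Eu N, ∀ g : G₁, ∀ z y₂, ∀ ξ ∈ G₂,
      W ((g : Eu N) + y₁) (y₂ + ξ) z = W ((g : Eu N) + y₁) y₂ z := by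
    rw [ae_all_iff]
    exact fun g => (measurePreserving_add_left volume (g : Eu N)).quasiMeasurePreserving.ae
      h1.periodic_snd
  have q1 := Measure.quasiMeasurePreserving_smul (volume : Measure (Eu N)) (inv_ne_zero hδ)
  have q2 := Measure.quasiMeasurePreserving_smul (volume : Measure (Eu N)) (inv_ne_zero hη)
  filter_upwards [q1.ae hB, q1.ae hQ₁.ae_covers, q2.ae h1.periodic_fst, q2.ae hQ₂.ae_covers]
    with x hB ⟨g₁, hg₁⟩ hA ⟨g₂, hg₂⟩ z
  have := hle _ hg₁ _ hg₂ z
  simp only [Submodule.vadd_def, vadd_eq_add] at this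
  rw [add_comm (g₂ : Eu N), hB g₁ z _ _ g₂.2, add_comm (g₁ : Eu N), hA z _ _ g₁.2] at this
  exact this

/-! ### Perimeter -/

/-- The directional derivative of a test function is a limit of difference quotients, and in the
integral these can be moved onto the indicator of `S`, where the translation bound applies. -/
theorem setIntegral_fderiv_le {N : ℕ} {Ω S : Set (Eu N)} (hΩ : IsOpen Ω)
    (hΩb : Bornology.IsBounded Ω) (hS : MeasurableSet S) (hSΩ : S ⊆ Ω)
    {C : ℝ≥0∞} (hCt : C ≠ ⊤) (hC : TranslationBound Ω C (S.indicator 1)) {g : Eu N → ℝ}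
    (hg : ContDiff ℝ 1 g) (hgc : HasCompactSupport g) (hgs : tsupport g ⊆ Ω)
    (hg1 : ∀ x, |g x| ≤ 1) (v : Eu N) :
    ∫ x in S, fderiv ℝ g x v ≤ C.toReal * ‖v‖ := by
  set χ : Eu N → ℝ := S.indicator 1 with hχ_def
  have hχ : Integrable χ := (integrable_indicator_iff hS).2
    (integrableOn_const ((measure_mono hSΩ).trans_lt hΩb.measure_lt_top).ne)
  obtain ⟨r, hr, hsub⟩ := exists_subset_deepInterior hΩ hgc hgs
  obtain ⟨L, hL⟩ := hg.lipschitzWith_of_hasCompactSupport hgc one_ne_zero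
  have hlim := hL.integral_inv_smul_sub_mul_tendsto_integral_lineDeriv_mul (μ := volume) hχ v
  have hval : ∫ x, lineDeriv ℝ g x v * χ x = ∫ x in S, fderiv ℝ g x v := by
    rw [← integral_indicator hS]
    congr 1
    ext1 x
    rw [(hg.differentiable one_ne_zero x).lineDeriv_eq_fderiv]
    by_cases hx : x ∈ S <;> simp [hχ_def, hx]
  rw [hval] at hlim
  refine le_of_tendsto hlim ?_
  have hsmall : ∀ᶠ t : ℝ in 𝓝[>] 0, ‖t • v‖ < r := by
    have : Tendsto (fun t : ℝ => ‖t • v‖) (𝓝 0) (𝓝 ‖(0 : ℝ) • v‖) :=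
      Continuous.tendsto (by fun_prop) 0
    rw [zero_smul, norm_zero] at this
    exact (this.mono_left nhdsWithin_le_nhds).eventually_lt_const hr
  filter_upwards [hsmall, self_mem_nhdsWithin] with t htr ht0
  have ht : 0 < t := ht0
  have i1 : Integrable fun x => g x * χ x :=
    integrable_smul_of_hasCompactSupport hg.continuous hgc hχ
  have i2 : Integrable fun x => g x * χ (x + -(t • v)) :=
    integrable_smul_of_hasCompactSupport hg.continuous hgc (hχ.comp_add_right _)
  have i3 : Integrable fun x => g (x + t • v) * χ x := by
    simpa using i2.comp_add_right (t • v)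
  have e1 : ∫ x, g (x + t • v) * χ x = ∫ x, g x * χ (x + -(t • v)) := by
    rw [← integral_add_right_eq_self (fun x => g x * χ (x + -(t • v))) (t • v)]
    simp
  have e2 : ∫ x, t⁻¹ • (g (x + t • v) - g x) * χ x
      = t⁻¹ * ∫ x, g x * (χ (x + -(t • v)) - χ x) := by
    simp_rw [mul_sub, smul_eq_mul, mul_assoc, sub_mul]
    rw [integral_sub i2 i1, ← e1, ← integral_sub i3 i1, ← integral_const_mul]
  have e3 : ‖∫ x, g x * (χ (x + -(t • v)) - χ x)‖ₑ ≤ C * ‖t • v‖ₑ := by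
    calc _ ≤ ∫⁻ x, ‖g x * (χ (x + -(t • v)) - χ x)‖ₑ := enorm_integral_le_lintegral_enorm _
      _ ≤ ∫⁻ x, (deepInterior Ω r).indicator (fun x => ‖χ (x + -(t • v)) - χ x‖ₑ) x := by
          refine lintegral_mono fun x => ?_
          by_cases hx : x ∈ deepInterior Ω r
          · rw [Set.indicator_of_mem hx, enorm_mul]
            refine mul_le_of_le_one_left' ?_
            rw [← ofReal_norm]
            exact ENNReal.ofReal_le_one.2 (hg1 x)
          · have : g x = 0 := image_eq_zero_of_notMem_tsupport fun h => hx (hsub h)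
            simp [this]
      _ = ∫⁻ x in deepInterior Ω r, ‖χ (x + -(t • v)) - χ x‖ₑ :=
          lintegral_indicator (isOpen_deepInterior _ _).measurableSet _
      _ ≤ C * ‖-(t • v)‖ₑ := hC _ _ (by rw [norm_neg]; exact htr.le)
      _ = _ := by rw [enorm_neg]
  have e4 : ∫ x, g x * (χ (x + -(t • v)) - χ x) ≤ C.toReal * (t * ‖v‖) := by
    refine (le_abs_self _).trans ?_
    rw [← Real.norm_eq_abs, ← toReal_enorm]
    refine (ENNReal.toReal_mono (by finiteness) e3).trans_eq ?_
    rw [ENNReal.toReal_mul, toReal_enorm, norm_smul, Real.norm_of_nonneg ht.le]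
  rw [e2]
  calc _ ≤ t⁻¹ * (C.toReal * (t * ‖v‖)) := by gcongr
    _ = _ := by field_simp

theorem perimeter_lt_top_of_translationBound {N : ℕ} {Ω S : Set (Eu N)} (hΩ : IsOpen Ω)
    (hΩb : Bornology.IsBounded Ω) (hS : MeasurableSet S) (hSΩ : S ⊆ Ω)
    {C : ℝ≥0∞} (hCt : C ≠ ⊤) (hC : TranslationBound Ω C (S.indicator 1)) :
    perimeter S Ω < ⊤ := by
  refine lt_of_le_of_lt (b := ENNReal.ofReal (∑ _j : Fin N, C.toReal)) ?_ ENNReal.ofReal_lt_top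
  refine iSup_le fun φ => iSup_le fun hφ => iSup_le fun hφc => iSup_le fun hφs => iSup_le fun hφ1 =>
    ENNReal.ofReal_le_ofReal ?_
  have hcomp : ∀ j : Fin N, ContDiff ℝ 1 fun x => φ x j := fun j =>
    (contDiff_piLp_apply (p := 2)).comp hφ
  have hsupp : ∀ j : Fin N, tsupport (fun x => φ x j) ⊆ tsupport φ := fun j =>
    closure_mono fun x hx h => hx (by simp [h])
  have hcs : ∀ j : Fin N, HasCompactSupport fun x => φ x j := fun j =>
    hφc.of_isClosed_subset (isClosed_tsupport _) (hsupp j)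
  have hder : ∀ (j : Fin N) x, (fderiv ℝ φ x (stdVec j)) j
      = fderiv ℝ (fun x => φ x j) x (stdVec j) := by
    intro j x
    have h1 := (EuclideanSpace.proj (𝕜 := ℝ) j).hasFDerivAt.comp x
      (hφ.differentiable one_ne_zero x).hasFDerivAt
    have h2 : fderiv ℝ (fun x => φ x j) x = (EuclideanSpace.proj (𝕜 := ℝ) j).comp (fderiv ℝ φ x) :=
      h1.fderiv
    rw [h2]
    rfl
  have hint : ∀ j ∈ Finset.univ,
      Integrable (fun x => fderiv ℝ (fun x => φ x j) x (stdVec j)) (volume.restrict S) :=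
    fun j _ => ((((hcomp j).continuous_fderiv one_ne_zero).clm_apply
      continuous_const).integrable_of_hasCompactSupport ((hcs j).fderiv_apply ℝ _)).restrict
  simp_rw [divergence, hder]
  rw [integral_finsetSum _ hint]
  refine Finset.sum_le_sum fun j _ => ?_
  refine (setIntegral_fderiv_le hΩ hΩb hS hSΩ hCt hC (hcomp j) (hcs j) ((hsupp j).trans hφs)
    (fun x => (PiLp.norm_apply_le (φ x) j).trans (hφ1 x)) (stdVec j)).trans_eq ?_
  simp


/-! ### The compactness theorem -/

theorem memW12_of_energy_lt_top {N M : ℕ} {Ω : Set (Eu N)} {W : Eu N → Eu N → Eu M → ℝ}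
    {η δ ε : ℝ} {u : LOne Ω M} (h : energy Ω W η δ ε u < ⊤) : MemW12 Ω u := by
  by_contra hn
  simp [energy, hn] at h

/-- The Modica–Mortola energy with the spatially homogeneous potential `W₁` is a lower bound. The
energy is a lower integral, which needs no measurability of `W`. -/
theorem modicaMortola_le_energy {N M : ℕ} {Ω : Set (Eu N)} {W : Eu N → Eu N → Eu M → ℝ}
    {W₁ : Eu M → ℝ} (hnn : ∀ z, 0 ≤ W₁ z) (hm : Measurable W₁) {η δ ε : ℝ} (hε : 0 < ε)
    (hW : ∀ᵐ x : Eu N, ∀ z, W₁ z ≤ W (δ⁻¹ • x) (η⁻¹ • x) z) {u : LOne Ω M} (h : MemW12 Ω u) :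
    (ENNReal.ofReal ε)⁻¹ * (∫⁻ x in Ω, ENNReal.ofReal (W₁ (u x)))
      + ENNReal.ofReal ε * gradEnergy Ω (weakGradient h) ≤ energy Ω W η δ ε u := by
  have hmu : Measurable fun x => W₁ (u x) := hm.comp (Lp.stronglyMeasurable u).measurable
  rw [energy, dif_pos h, gradEnergy, ← lintegral_const_mul _ hmu.ennreal_ofReal,
    ← lintegral_const_mul' _ _ ENNReal.ofReal_ne_top,
    ← lintegral_add_left (hmu.ennreal_ofReal.const_mul _)]
  refine lintegral_mono_ae ?_
  filter_upwards [ae_restrict_of_ae hW] with x hx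
  rw [← ENNReal.ofReal_inv_of_pos hε, ← ENNReal.ofReal_mul (by positivity),
    ← ENNReal.ofReal_mul hε.le, ← ENNReal.ofReal_add (mul_nonneg (by positivity) (hnn _))
      (by positivity)]
  refine ENNReal.ofReal_le_ofReal ?_
  rw [one_div]
  gcongr
  exact hx _

theorem enorm_sub_le_of_abs_sub_le {M : ℕ} {W₁ : Eu M → ℝ} (hnn : ∀ z, 0 ≤ W₁ z)
    {ψ : Eu M → ℝ} {A B : ℝ} (hA : 0 ≤ A) (hB : 0 ≤ B)
    (h : ∀ p q (t : ℝ), 0 < t →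
      |ψ q - ψ p| ≤ A * (t * W₁ p + t⁻¹ * ‖q - p‖ ^ 2) + B * ‖q - p‖ ^ 2)
    (p q : Eu M) (t : ℝ≥0∞) (ht0 : t ≠ 0) (ht : t ≠ ⊤) :
    ‖ψ q - ψ p‖ₑ ≤ ENNReal.ofReal A * (t * ENNReal.ofReal (W₁ p) + t⁻¹ * ‖q - p‖ₑ ^ 2)
      + ENNReal.ofReal B * ‖q - p‖ₑ ^ 2 := by
  have htp : 0 < t.toReal := ENNReal.toReal_pos ht0 ht
  have hW := hnn p
  rw [← ofReal_norm, ← ofReal_norm, Real.norm_eq_abs]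
  refine (ENNReal.ofReal_le_ofReal (h p q t.toReal htp)).trans_eq ?_
  rw [ENNReal.ofReal_add (by positivity) (by positivity), ENNReal.ofReal_mul hA,
    ENNReal.ofReal_mul hB, ENNReal.ofReal_add (by positivity) (by positivity),
    ENNReal.ofReal_mul htp.le, ENNReal.ofReal_mul (by positivity), ENNReal.ofReal_inv_of_pos htp,
    ENNReal.ofReal_toReal ht, ENNReal.ofReal_pow (norm_nonneg _)]

/-- The translation bound is closed under convergence in `L¹(Ω)`: lower semicontinuity of the
variation. -/
theorem translationBound_of_tendsto {N : ℕ} {Ω : Set (Eu N)} (hΩ : MeasurableSet Ω) {C : ℝ≥0∞}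
    {w : ℕ → Eu N → ℝ} {v : Eu N → ℝ} (hw : ∀ n, Measurable (w n)) (hv : Measurable v)
    (hC : ∀ n, TranslationBound Ω C (w n))
    (hlim : Tendsto (fun n => ∫⁻ x in Ω, ‖v x - w n x‖ₑ) atTop (𝓝 0)) :
    TranslationBound Ω C v := by
  intro e r he
  have hm : ∀ n, Measurable fun x => ‖v x - w n x‖ₑ := fun n => (hv.sub (hw n)).enorm
  have hKm : MeasurableSet (deepInterior Ω r) := (isOpen_deepInterior _ _).measurableSet
  have key : ∀ n, ∫⁻ x in deepInterior Ω r, ‖v (x + e) - v x‖ₑ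
      ≤ (∫⁻ x in Ω, ‖v x - w n x‖ₑ) + C * ‖e‖ₑ + ∫⁻ x in Ω, ‖v x - w n x‖ₑ := by
    intro n
    have hmw : Measurable fun x => ‖w n (x + e) - w n x‖ₑ := by have := hw n; fun_prop
    calc _ ≤ ∫⁻ x in deepInterior Ω r, (‖v (x + e) - w n (x + e)‖ₑ + ‖w n (x + e) - w n x‖ₑ
            + ‖v x - w n x‖ₑ) := by
          refine lintegral_mono fun x => ?_
          have : v (x + e) - v x
              = (v (x + e) - w n (x + e)) + (w n (x + e) - w n x) - (v x - w n x) := by ring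
          rw [this]
          refine enorm_sub_le.trans ?_
          gcongr
          exact enorm_add_le _ _
      _ = (∫⁻ x in deepInterior Ω r, ‖v (x + e) - w n (x + e)‖ₑ)
            + (∫⁻ x in deepInterior Ω r, ‖w n (x + e) - w n x‖ₑ)
            + ∫⁻ x in deepInterior Ω r, ‖v x - w n x‖ₑ := by
          rw [lintegral_add_right _ (hm n), lintegral_add_right _ hmw]
      _ ≤ _ := by
          refine add_le_add (add_le_add ?_ (hC n e r he))
            (lintegral_mono_set (deepInterior_subset _ _))
          · rw [← lintegral_indicator hKm, ← lintegral_indicator hΩ,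
              ← lintegral_add_right_eq_self (Ω.indicator _) e]
            refine lintegral_mono fun x => ?_
            by_cases hx : x ∈ deepInterior Ω r
            · rw [Set.indicator_of_mem hx,
                Set.indicator_of_mem (add_mem_of_mem_deepInterior hx he)]
            · simp [hx]
  have h2 := (hlim.add_const (C * ‖e‖ₑ)).add hlim
  rw [zero_add, add_zero] at h2
  exact ge_of_tendsto' h2 key

/-- The compactness theorem for the Modica–Mortola energies with the potential `W₁`. -/
theorem exists_subseq_tendsto_of_modicaMortola {N M : ℕ} {Ω : Set (Eu N)} (hΩ : IsOpen Ω)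
    (hΩb : Bornology.IsBounded Ω) {W₁ : Eu M → ℝ} {a b : Eu M}
    (hnn : ∀ z, 0 ≤ W₁ z) (hlsc : LowerSemicontinuous W₁)
    (hpos : ∀ z, z ≠ a → z ≠ b → 0 < W₁ z) (h3 : HypGrowth W₁)
    {ε : ℕ → ℝ} (hε : ∀ n, 0 < ε n) (hε0 : Tendsto ε atTop (𝓝 0)) {u : ℕ → LOne Ω M}
    (hu : ∀ n, MemW12 Ω (u n)) {E : ℝ≥0∞} (hE : E ≠ ⊤)
    (hb : ∀ n, (ENNReal.ofReal (ε n))⁻¹ * (∫⁻ x in Ω, ENNReal.ofReal (W₁ (u n x)))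
      + ENNReal.ofReal (ε n) * gradEnergy Ω (weakGradient (hu n)) ≤ E) :
    ∃ (k : ℕ → ℕ) (v : LOne Ω M), StrictMono k ∧ MemBVTwo a b v ∧
      Tendsto (fun n => u (k n)) atTop (𝓝 v) := by
  have hum : ∀ n, Measurable (u n) := fun n => (Lp.stronglyMeasurable (u n)).measurable
  have hΩt : volume Ω ≠ ⊤ := hΩb.measure_lt_top.ne
  have hε1 : ∀ n, ENNReal.ofReal (ε n) ≠ 0 := fun n => (ENNReal.ofReal_pos.2 (hε n)).ne'
  have hpot : Tendsto (fun n => ∫⁻ x in Ω, ENNReal.ofReal (W₁ (u n x))) atTop (𝓝 0) := by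
    have h1 : Tendsto (fun n => ENNReal.ofReal (ε n) * E) atTop (𝓝 (ENNReal.ofReal 0 * E)) :=
      ENNReal.Tendsto.mul_const (ENNReal.tendsto_ofReal hε0) (Or.inr hE)
    rw [ENNReal.ofReal_zero, zero_mul] at h1
    refine tendsto_of_tendsto_of_tendsto_of_le_of_le tendsto_const_nhds h1
      (fun n => zero_le) fun n => ?_
    have h2 := le_self_add.trans (hb n)
    rwa [ENNReal.inv_mul_le_iff (hε1 n) ENNReal.ofReal_ne_top] at h2
  have hgrad : ∀ n, gradEnergy Ω (weakGradient (hu n)) ≠ ⊤ := by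
    intro n hn
    have h2 := le_add_self.trans (hb n)
    rw [hn, ENNReal.mul_top (hε1 n)] at h2
    exact hE (top_le_iff.1 h2)
  obtain ⟨ψ, hψc, hψ0, hψ1, hψa, hψb, ⟨L, hL, hψL⟩, A, B, hA, hB, hψ⟩ :=
    exists_phaseFunction hnn hlsc hpos
  have hC : ∀ n, TranslationBound Ω (ENNReal.ofReal A * E) fun x => ψ (u n x) := by
    intro n e r he
    refine lintegral_sub_le_of_step (w := fun x => ψ (u n x)) (hψc.measurable.comp (hum n))
      (D := ENNReal.ofReal B * gradEnergy Ω (weakGradient (hu n)))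
      (ENNReal.mul_ne_top ENNReal.ofReal_ne_top (hgrad n)) (fun e r he => ?_) he
    refine (lintegral_comp_sub_le_step (Ω := Ω) (hum n) hlsc.measurable.ennreal_ofReal
      (enorm_sub_le_of_abs_sub_le hnn hA hB hψ) (hε1 n) ENNReal.ofReal_ne_top
      (I := gradEnergy Ω (weakGradient (hu n)))
      (lintegral_enorm_sub_sq_le hΩ hΩb (hu n).1 (hu n).2.choose_spec.1
        (hu n).2.choose_spec.2 he)).trans ?_
    gcongr
    exact hb n
  obtain ⟨k, hk, hcau⟩ := exists_subseq_cauchy_of_translationBound hΩ hΩb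
    (fun n => hψc.measurable.comp (hum n)) (fun n x => abs_le.2
      ⟨(neg_nonpos.2 zero_le_one).trans (hψ0 _), hψ1 _⟩)
    (ENNReal.mul_ne_top ENNReal.ofReal_ne_top hE) hC
  have hpotk := hpot.comp hk.tendsto_atTop
  -- `P z` is the point with phase `ψ z` on the segment between the wells.
  set P : Eu M → Eu M := fun z => ψ z • a + (1 - ψ z) • b with hP
  have hPc : Continuous P := by fun_prop
  have hPa : P a = a := by simp [hP, hψa]
  have hPb : P b = b := by
    rcases eq_or_ne b a with rfl | hab
    · exact hPa
    · simp [hP, hψb hab]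
  have hPn : ∀ z, ‖P z‖ ≤ ‖a‖ + ‖b‖ := by
    intro z
    refine (norm_add_le _ _).trans ?_
    rw [norm_smul, norm_smul, Real.norm_of_nonneg (hψ0 z),
      Real.norm_of_nonneg (sub_nonneg.2 (hψ1 z))]
    have := hψ0 z
    gcongr
    · exact mul_le_of_le_one_left (norm_nonneg _) (hψ1 z)
    · exact mul_le_of_le_one_left (norm_nonneg _) (by linarith)
  have hres := tendsto_lintegral_of_tendsto_potential hΩt hnn hlsc hpos h3
    (f := fun z => ‖z - P z‖) (by fun_prop) (by simp [hPa]) (by simp [hPb])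
    (add_nonneg (norm_nonneg a) (norm_nonneg b))
    (fun z => (norm_sub_le _ _).trans (by gcongr; exact hPn z)) hpotk
  simp only [ofReal_norm] at hres
  have hmres : ∀ n, Measurable fun x => ‖u n x - P (u n x)‖ₑ := fun n =>
    ((hum n).sub (hPc.measurable.comp (hum n))).enorm
  have hCauchy : CauchySeq fun n => u (k n) := by
    rw [EMetric.cauchySeq_iff_NNReal]
    intro τ hτ
    have hτ' : (τ : ℝ≥0∞) ≠ 0 := ENNReal.coe_ne_zero.2 hτ.ne'
    set σ : ℝ≥0∞ := τ / 4 with hσ_def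
    have hσ : 0 < σ := ENNReal.div_pos hτ' (by simp)
    have hσt : σ ≠ ⊤ := ENNReal.div_ne_top ENNReal.coe_ne_top (by simp)
    obtain ⟨n₀, hn₀⟩ := hcau (σ / (‖a - b‖ₑ + 1)) (ENNReal.div_pos hσ.ne' (by finiteness))
    obtain ⟨n₁, hn₁⟩ := eventually_atTop.1 (hres.eventually_lt_const hσ)
    refine ⟨max n₀ n₁, fun n hn => ?_⟩
    set m := max n₀ n₁
    have hw : ‖a - b‖ₑ * ∫⁻ x in Ω, ‖ψ (u (k n) x) - ψ (u (k m) x)‖ₑ ≤ σ := by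
      calc _ ≤ (‖a - b‖ₑ + 1) * (σ / (‖a - b‖ₑ + 1)) := by
            refine mul_le_mul' le_self_add ?_
            exact hn₀ n ((le_max_left _ _).trans hn) m (le_max_left _ _)
        _ = σ := ENNReal.mul_div_cancel (by simp) (by finiteness)
    have hpt : ∀ x, ‖u (k n) x - u (k m) x‖ₑ ≤ ‖u (k n) x - P (u (k n) x)‖ₑ
        + ‖a - b‖ₑ * ‖ψ (u (k n) x) - ψ (u (k m) x)‖ₑ + ‖u (k m) x - P (u (k m) x)‖ₑ := by
      intro x
      have : u (k n) x - u (k m) x = (u (k n) x - P (u (k n) x))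
          + (ψ (u (k n) x) - ψ (u (k m) x)) • (a - b) - (u (k m) x - P (u (k m) x)) := by
        simp only [hP]
        module
      rw [this]
      refine enorm_sub_le.trans ?_
      gcongr
      refine (enorm_add_le _ _).trans ?_
      rw [enorm_smul, mul_comm]
    calc edist (u (k n)) (u (k m)) = ∫⁻ x in Ω, ‖u (k n) x - u (k m) x‖ₑ := by
          rw [L1.edist_def]
          simp_rw [edist_eq_enorm_sub]
      _ ≤ ∫⁻ x in Ω, (‖u (k n) x - P (u (k n) x)‖ₑ
            + ‖a - b‖ₑ * ‖ψ (u (k n) x) - ψ (u (k m) x)‖ₑ + ‖u (k m) x - P (u (k m) x)‖ₑ) :=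
          lintegral_mono hpt
      _ = (∫⁻ x in Ω, ‖u (k n) x - P (u (k n) x)‖ₑ)
            + ‖a - b‖ₑ * (∫⁻ x in Ω, ‖ψ (u (k n) x) - ψ (u (k m) x)‖ₑ)
            + ∫⁻ x in Ω, ‖u (k m) x - P (u (k m) x)‖ₑ := by
          rw [lintegral_add_right _ (hmres _), lintegral_add_left (hmres _),
            lintegral_const_mul' _ _ enorm_ne_top]
      _ ≤ σ + σ + σ := by
          gcongr
          · exact (hn₁ n ((le_max_right _ _).trans hn)).le
          · exact (hn₁ m (le_max_right _ _)).le
      _ < σ + σ + σ + σ := ENNReal.lt_add_right (by finiteness) hσ.ne'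
      _ = 4 * σ := by ring
      _ = τ := ENNReal.mul_div_cancel (by simp) (by simp)
  obtain ⟨v, hv⟩ := cauchySeq_tendsto_of_complete hCauchy
  have hvm : Measurable v := (Lp.stronglyMeasurable v).measurable
  have hedist : Tendsto (fun n => ∫⁻ x in Ω, ‖v x - u (k n) x‖ₑ) atTop (𝓝 0) := by
    have := tendsto_iff_edist_tendsto_0.1 hv
    refine this.congr fun n => ?_
    rw [edist_comm, L1.edist_def]
    simp_rw [edist_eq_enorm_sub]
  have hvab : ∀ᵐ x ∂(volume.restrict Ω), v x = a ∨ v x = b := by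
    have hdist := tendsto_lintegral_of_tendsto_potential hΩt hnn hlsc hpos h3
      (f := fun z => min ‖z - a‖ ‖z - b‖) (by fun_prop) (by simp) (by simp) (norm_nonneg a)
      (fun z => (min_le_left _ _).trans (norm_sub_le _ _)) hpotk
    have hlim := hdist.add hedist
    rw [zero_add] at hlim
    have hzero : ∫⁻ x in Ω, ENNReal.ofReal (min ‖v x - a‖ ‖v x - b‖) = 0 := by
      refine le_antisymm (ge_of_tendsto' hlim fun n => ?_) zero_le
      have hm : Measurable fun x => ‖v x - u (k n) x‖ₑ := (hvm.sub (hum _)).enorm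
      rw [← lintegral_add_right _ hm]
      refine lintegral_mono fun x => ?_
      rw [← ofReal_norm, ← ENNReal.ofReal_add (by positivity) (by positivity)]
      refine ENNReal.ofReal_le_ofReal ?_
      rw [← min_add_add_right]
      refine min_le_min ?_ ?_ <;> rw [add_comm] <;>
        exact norm_sub_le_norm_sub_add_norm_sub _ _ _
    rw [lintegral_eq_zero_iff (by fun_prop)] at hzero
    filter_upwards [hzero] with x hx
    have hx' : min ‖v x - a‖ ‖v x - b‖ ≤ 0 := ENNReal.ofReal_eq_zero.1 hx
    rcases min_le_iff.1 hx' with h | h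
    · exact Or.inl (sub_eq_zero.1 (norm_le_zero_iff.1 h))
    · exact Or.inr (sub_eq_zero.1 (norm_le_zero_iff.1 h))
  have hSm : MeasurableSet {x | x ∈ Ω ∧ v x = a} :=
    hΩ.measurableSet.inter (hvm (measurableSet_singleton a))
  refine ⟨k, v, hk, ⟨hvab, ?_⟩, hv⟩
  -- The indicator of `{v = a}` is `ψ ∘ v` almost everywhere, the `L¹` limit of the `ψ ∘ uₙ`.
  refine perimeter_lt_top_of_translationBound hΩ hΩb hSm (fun x hx => hx.1)
    (ENNReal.mul_ne_top ENNReal.ofReal_ne_top hE)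
    (translationBound_of_tendsto hΩ.measurableSet
      (fun n => hψc.measurable.comp (hum (k n))) (measurable_one.indicator hSm)
      (fun n => hC (k n)) ?_)
  have hlim : Tendsto (fun n => ENNReal.ofReal L * ∫⁻ x in Ω, ‖v x - u (k n) x‖ₑ) atTop
      (𝓝 (ENNReal.ofReal L * 0)) :=
    ENNReal.Tendsto.const_mul hedist (Or.inr ENNReal.ofReal_ne_top)
  rw [mul_zero] at hlim
  refine tendsto_of_tendsto_of_tendsto_of_le_of_le tendsto_const_nhds hlim
    (fun n => zero_le) fun n => ?_
  rw [← lintegral_const_mul' _ _ ENNReal.ofReal_ne_top]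
  refine lintegral_mono_ae ?_
  filter_upwards [hvab, ae_restrict_mem hΩ.measurableSet] with x hx hxΩ
  have hind : Set.indicator {x | x ∈ Ω ∧ v x = a} (1 : Eu N → ℝ) x = ψ (v x) := by
    by_cases hxa : v x = a
    · rw [Set.indicator_of_mem (show x ∈ {x | x ∈ Ω ∧ v x = a} from ⟨hxΩ, hxa⟩), hxa, hψa]
      rfl
    · have hxb := hx.resolve_left hxa
      rw [Set.indicator_of_notMem (fun h => hxa h.2), hxb, hψb (fun h => hxa (hxb.trans h))]
  rw [hind, ← ofReal_norm, ← ofReal_norm, ← ENNReal.ofReal_mul hL]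
  exact ENNReal.ofReal_le_ofReal (hψL _ _)

end PhaseSep

theorem theorem1 {N M : ℕ}
    (Ω : Set (PhaseSep.Eu N)) (hΩ : IsOpen Ω) (hΩb : Bornology.IsBounded Ω)
    (G₁ G₂ : Submodule ℤ (PhaseSep.Eu N))
    [DiscreteTopology G₁] [IsZLattice ℝ G₁] [DiscreteTopology G₂] [IsZLattice ℝ G₂]
    (Q₁ Q₂ : Set (PhaseSep.Eu N))
    (hQ₁ : IsAddFundamentalDomain G₁ Q₁ (volume : Measure (PhaseSep.Eu N)))
    (hQ₂ : IsAddFundamentalDomain G₂ Q₂ (volume : Measure (PhaseSep.Eu N)))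
    (W : PhaseSep.Eu N → PhaseSep.Eu N → PhaseSep.Eu M → ℝ)
    (W₁ : PhaseSep.Eu M → ℝ) (a b : PhaseSep.Eu M)
    (h1 : PhaseSep.HypCaratheodory G₁ G₂ Q₁ Q₂ W)
    (h2 : PhaseSep.HypWells Q₁ Q₂ W a b)
    (h3 : PhaseSep.HypGrowth W₁)
    (h5 : PhaseSep.HypLowerBound Q₁ Q₂ W a b W₁)
    (η δ ε : ℕ → ℝ)
    (hη : ∀ n, 0 < η n) (hδ : ∀ n, 0 < δ n) (hε : ∀ n, 0 < ε n)
    (hη0 : Tendsto η atTop (𝓝 0)) (hδ0 : Tendsto δ atTop (𝓝 0)) (hε0 : Tendsto ε atTop (𝓝 0))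
    (hηδ : Tendsto (fun n => η n / δ n) atTop (𝓝 0))
    (hδε : Tendsto (fun n => δ n / ε n) atTop (𝓝 0))
    (u : ℕ → PhaseSep.LOne Ω M)
    (hu : (⨆ n, PhaseSep.energy Ω W (η n) (δ n) (ε n) (u n)) < ⊤) :
    ∃ (k : ℕ → ℕ) (v : PhaseSep.LOne Ω M), StrictMono k ∧
      (∀ n, PhaseSep.MemW12 Ω (u (k n))) ∧
      PhaseSep.MemBVTwo a b v ∧
      Tendsto (fun n => u (k n)) atTop (𝓝 v) := by
  have hle : ∀ n, PhaseSep.energy Ω W (η n) (δ n) (ε n) (u n)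
      ≤ ⨆ n, PhaseSep.energy Ω W (η n) (δ n) (ε n) (u n) :=
    le_iSup (fun n => PhaseSep.energy Ω W (η n) (δ n) (ε n) (u n))
  have hmem : ∀ n, PhaseSep.MemW12 Ω (u n) := fun n =>
    PhaseSep.memW12_of_energy_lt_top ((hle n).trans_lt hu)
  obtain ⟨k, v, hk, hv, hlim⟩ := PhaseSep.exists_subseq_tendsto_of_modicaMortola hΩ hΩb h5.nonneg
    h5.lsc h5.pos h3 hε hε0 hmem hu.ne fun n =>
      (PhaseSep.modicaMortola_le_energy h5.nonneg h5.lsc.measurable (hε n)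
        (PhaseSep.ae_le_potential hQ₁ hQ₂ h1 h5.le (hδ n).ne' (hη n).ne') (hmem n)).trans (hle n)
  exact ⟨k, v, hk, fun n => hmem (k n), hv, hlim⟩
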